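/- Let $X$ be a connected (Hausdorff, second countable) complex manifold of dimension $n$ with a Hermitian form $\Theta$, i.e. a smooth real $J$-invariant $2$-form such that $g(u,v)=\Theta(u,Jv)$ is a Riemannian metric, and let $\mathrm{dV}=\Theta^n/n!$ be its volume measure (the Riemannian volume of $g$). Let $L$ be a holomorphic line bundle on $X$ with a smooth Hermitian metric $h$. Let $H^0(X,L)$ be the space of holomorphic sections of $L$, with the topology defined by the seminorms $s\mapsto\sup_{K}|s|_h$, $K\subset X$ compact, and with its Borel $\sigma$-algebra. Let $H^0_{(2)}(X,L)$ be the space of those $s\in H^0(X,L)$ with $\int_X|s|_h^2\,\mathrm{dV}<\infty$, with the inner product $\langle s,t\rangle=\int_X\langle s,t\rangle_h\,\mathrm{dV}$, and let $d\in\mathbb N\cup\{\infty\}$ be its dimension. (1) Let $\{S_j\}_{0\le j<d}$ be an orthonormal (Hilbert) basis of $H^0_{(2)}(X,L)$ and let $\{\eta_j\}_{0\le j<d}$ be i.i.d. centered Gaussian random variables, real or complex, on a probability space $(\Omega,\mathbb P)$. Then there is a random variable $\psi$ on $\Omega$ with values in $H^0(X,L)$ such that, almost surely, the partial sums $\sum_{j<N,\,j<d}\eta_jS_j$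 converge to $\psi$ as $N\to\infty$, uniformly on every compact subset of $X$. In other words, the series $\psi^S_\eta=\sum_j\eta_jS_j$ converges almost surely, locally uniformly, to a holomorphic section of $L$. (2) If $S=\{S_j\}$ and $S'=\{S'_j\}$ are two orthonormal bases as in (1), and $\eta=\{\eta_j\}$, $\eta'=\{\eta'_j\}$ are two families of i.i.d. standard complex Gaussian random variables, possibly the same and possibly on different probability spaces, then the random holomorphic sections $\psi^{S}_{\eta}$ and $\psi^{S'}_{\eta'}$ have the same distribution on $H^0(X,L)$. Here a standard complex Gaussian is a random variable with the distribution of $(U+\sqrt{-1}\,V)/\sqrt2$, where $U,V$ are independent standard real Gaussians. -/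

import Mathlib

open Bundle Filter MeasureTheory ProbabilityTheory Set
open scoped Manifold ContDiff Topology ComplexConjugate ENNReal

noncomputable section

namespace GaussSec

/-! ### Hermitian forms on a complex manifold and their volume measure -/

section Base

variable {n : ℕ} {X : Type*} [TopologicalSpace X] [ChartedSpace (EuclideanSpace ℂ (Fin n)) X]

/-- The differential of the inverse of a chart `φ` at the point `z` of its target. It sends
a coordinate vector to the tangent vector of `X` at `φ.symm z` that it represents. -/
def chartVec (φ : OpenPartialHomeomorph X (EuclideanSpace ℂ (Fin n)))
    (z : EuclideanSpace ℂ (Fin n)) :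
    EuclideanSpace ℂ (Fin n) →L[ℂ]
      TangentSpace 𝓘(ℂ, EuclideanSpace ℂ (Fin n)) (φ.symm z) :=
  mfderiv 𝓘(ℂ, EuclideanSpace ℂ (Fin n)) 𝓘(ℂ, EuclideanSpace ℂ (Fin n)) φ.symm z

variable (n X) in
/-- A Hermitian form `Θ` on the complex manifold `X`: a smooth real two-form which is invariant
under the complex structure `J` (multiplication by `Complex.I` on tangent spaces) and positive,
i.e. `g(u, v) = Θ(u, J v)` is a Riemannian metric. -/
structure HermitianForm where
  /-- the two-form on each tangent space -/
  form (x : X) : TangentSpace 𝓘(ℂ, EuclideanSpace ℂ (Fin n)) x →ₗ[ℝ]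
    TangentSpace 𝓘(ℂ, EuclideanSpace ℂ (Fin n)) x →ₗ[ℝ] ℝ
  alternating : ∀ x v, form x v v = 0
  invariant : ∀ x u v, form x (Complex.I • u) (Complex.I • v) = form x u v
  positive : ∀ x v, v ≠ 0 → 0 < form x v (Complex.I • v)
  /-- the coefficients of `Θ` are smooth functions in every chart -/
  smooth : ∀ φ ∈ atlas (EuclideanSpace ℂ (Fin n)) X, ∀ u v : EuclideanSpace ℂ (Fin n),
    ContDiffOn ℝ ∞ (fun z => form (φ.symm z) (chartVec φ z u) (chartVec φ z v)) φ.target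

/-- The real coordinate frame `∂/∂x₁, …, ∂/∂xₙ, ∂/∂y₁, …, ∂/∂yₙ` of `ℂⁿ`, `z = x + i y`. -/
def coordFrame (n : ℕ) : Fin n ⊕ Fin n → EuclideanSpace ℂ (Fin n) :=
  Sum.elim (fun j => EuclideanSpace.single j 1) (fun j => EuclideanSpace.single j Complex.I)

namespace HermitianForm

variable (Θ : HermitianForm n X)

/-- The associated Riemannian metric `g(u, v) = Θ(u, J v)`. -/
def metric (x : X) (u v : TangentSpace 𝓘(ℂ, EuclideanSpace ℂ (Fin n)) x) : ℝ :=
  Θ.form x u (Complex.I • v)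

/-- The density `√(det g)` of the volume form `Θⁿ / n!`, i.e. of the Riemannian volume form of
`g`, with respect to Lebesgue measure in the chart `φ`. -/
def volDensity (φ : OpenPartialHomeomorph X (EuclideanSpace ℂ (Fin n)))
    (z : EuclideanSpace ℂ (Fin n)) : ℝ :=
  Real.sqrt (Matrix.det (Matrix.of fun a b : Fin n ⊕ Fin n =>
    Θ.metric (φ.symm z) (chartVec φ z (coordFrame n a)) (chartVec φ z (coordFrame n b))))

variable [MeasurableSpace X]

/-- The measure `√(det g) dλ` in the domain of the chart `φ`, extended by zero to `X`. -/
def chartVol (φ : OpenPartialHomeomorph X (EuclideanSpace ℂ (Fin n))) : Measure X :=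
  Measure.map φ.symm ((volume.restrict φ.target).withDensity
    fun z => ENNReal.ofReal (Θ.volDensity φ z))

/-- The volume measure `dV = Θⁿ / n!` on `X`. The measures `√(det g) dλ` of the various charts
agree where the charts overlap; `dV` is the measure obtained by gluing them, which is the least
measure dominating all of them. See `vol_restrict_source`. -/
def vol : Measure X :=
  ⨆ φ ∈ atlas (EuclideanSpace ℂ (Fin n)) X, Θ.chartVol φ

variable {Θ} in
lemma contDiffOn_metric {φ : OpenPartialHomeomorph X (EuclideanSpace ℂ (Fin n))}
    (hφ : φ ∈ atlas (EuclideanSpace ℂ (Fin n)) X) (u v : EuclideanSpace ℂ (Fin n)) :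
    ContDiffOn ℝ ∞ (fun z => Θ.metric (φ.symm z) (chartVec φ z u) (chartVec φ z v)) φ.target := by
  refine (Θ.smooth φ hφ u (Complex.I • v)).congr fun z _ => ?_
  rw [metric, (chartVec φ z).map_smul]

lemma continuousOn_volDensity {φ : OpenPartialHomeomorph X (EuclideanSpace ℂ (Fin n))}
    (hφ : φ ∈ atlas (EuclideanSpace ℂ (Fin n)) X) :
    ContinuousOn (Θ.volDensity φ) φ.target := by
  unfold volDensity
  simp only [Matrix.det_apply]
  refine ContinuousOn.sqrt (continuousOn_finsetSum _ fun σ _ => ContinuousOn.const_smul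
    (continuousOn_finsetProd _ fun a _ => ?_) _)
  exact (contDiffOn_metric hφ _ _).continuousOn

lemma measurableSet_chart_image [BorelSpace X]
    {φ : OpenPartialHomeomorph X (EuclideanSpace ℂ (Fin n))}
    {A : Set X} (hA : MeasurableSet A) (hAs : A ⊆ φ.source) : MeasurableSet (φ '' A) := by
  rw [φ.image_eq_target_inter_inv_preimage hAs, ← Subtype.image_preimage_coe]
  have h1 : Measurable (φ.target.domRestrict φ.symm) :=
    (continuousOn_iff_continuous_domRestrict.1 φ.continuousOn_symm).measurable
  exact φ.open_target.measurableSet.subtype_image (h1 hA)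

lemma chartVol_apply [BorelSpace X] {φ : OpenPartialHomeomorph X (EuclideanSpace ℂ (Fin n))}
    {A : Set X} (hA : MeasurableSet A) :
    Θ.chartVol φ A = ∫⁻ z in φ '' (A ∩ φ.source), ENNReal.ofReal (Θ.volDensity φ z) := by
  have hm : AEMeasurable φ.symm (volume.restrict φ.target) :=
    φ.continuousOn_symm.aemeasurable φ.open_target.measurableSet
  have himg : φ '' (A ∩ φ.source) = φ.symm ⁻¹' A ∩ φ.target := by
    rw [φ.image_eq_target_inter_inv_preimage inter_subset_right]
    ext z
    constructor
    · rintro ⟨h1, h2⟩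
      exact ⟨h2.1, h1⟩
    · rintro ⟨h1, h2⟩
      exact ⟨h2, h1, φ.map_target h2⟩
  rw [chartVol, Measure.map_apply_of_aemeasurable
    (hm.mono_ac (withDensity_absolutelyContinuous _ _)) hA, withDensity_apply',
    Measure.restrict_restrict', himg]
  exact φ.open_target.measurableSet

/-- The real coordinate basis. -/
lemma exists_basis (n : ℕ) : ∃ b : Module.Basis (Fin n ⊕ Fin n) ℝ (EuclideanSpace ℂ (Fin n)),
    ⇑b = coordFrame n := by
  let b := (Complex.basisOneI.smulTower (EuclideanSpace.basisFun (Fin n) ℂ).toBasis)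
  let e : Fin 2 × Fin n ≃ Fin n ⊕ Fin n :=
    (Equiv.prodCongrLeft fun _ => finTwoEquiv).trans (Equiv.boolProdEquivSum (Fin n))
  refine ⟨b.reindex e, ?_⟩
  ext1 a
  rcases a with j | j
  · have : finTwoEquiv.symm false = 0 := rfl
    simp [b, e, coordFrame, this]
  · have : finTwoEquiv.symm true = 1 := rfl
    ext i
    simp [b, e, coordFrame, this]

/-- Change of charts for the coefficients of the metric. -/
lemma metric_change [IsManifold 𝓘(ℂ, EuclideanSpace ℂ (Fin n)) ω X]
    {φ ψ : OpenPartialHomeomorph X (EuclideanSpace ℂ (Fin n))}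
    (hφ : φ ∈ atlas (EuclideanSpace ℂ (Fin n)) X) (hψ : ψ ∈ atlas (EuclideanSpace ℂ (Fin n)) X)
    {z : EuclideanSpace ℂ (Fin n)} (hz : z ∈ φ.target) (hz' : φ.symm z ∈ ψ.source) :
    ∃ T : EuclideanSpace ℂ (Fin n) →L[ℂ] EuclideanSpace ℂ (Fin n),
      HasFDerivAt (fun w => ψ (φ.symm w)) T z ∧
      ∀ u v, Θ.metric (φ.symm z) (chartVec φ z u) (chartVec φ z v) =
        Θ.metric (ψ.symm (ψ (φ.symm z))) (chartVec ψ (ψ (φ.symm z)) (T u))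
          (chartVec ψ (ψ (φ.symm z)) (T v)) := by
  have : IsManifold 𝓘(ℂ, EuclideanSpace ℂ (Fin n)) 1 X := .of_le (n := ω) le_top
  have h1 : MDifferentiableAt 𝓘(ℂ, EuclideanSpace ℂ (Fin n)) 𝓘(ℂ, EuclideanSpace ℂ (Fin n))
      φ.symm z := mdifferentiableAt_atlas_symm hφ hz
  have h2 : MDifferentiableAt 𝓘(ℂ, EuclideanSpace ℂ (Fin n)) 𝓘(ℂ, EuclideanSpace ℂ (Fin n))
      ψ (φ.symm z) := mdifferentiableAt_atlas hψ hz'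
  have h3 : MDifferentiableAt 𝓘(ℂ, EuclideanSpace ℂ (Fin n)) 𝓘(ℂ, EuclideanSpace ℂ (Fin n))
      ψ.symm (ψ (φ.symm z)) := mdifferentiableAt_atlas_symm hψ (ψ.map_source hz')
  have h4 := h2.comp z h1
  have hx : ψ.symm (ψ (φ.symm z)) = φ.symm z := ψ.left_inv hz'
  refine ⟨fderiv ℂ (fun w => ψ (φ.symm w)) z, h4.differentiableAt.hasFDerivAt, fun u v => ?_⟩
  have hev : φ.symm =ᶠ[𝓝 z] ψ.symm ∘ (ψ ∘ φ.symm) := by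
    have : φ.symm ⁻¹' ψ.source ∈ 𝓝 z :=
      (φ.continuousAt_symm hz).preimage_mem_nhds (ψ.open_source.mem_nhds hz')
    filter_upwards [this] with w hw
    exact (ψ.left_inv hw).symm
  have key : ∀ u : EuclideanSpace ℂ (Fin n), (chartVec φ z u : EuclideanSpace ℂ (Fin n)) =
      chartVec ψ (ψ (φ.symm z)) (fderiv ℂ (fun w => ψ (φ.symm w)) z u) := fun u => by
    have e1 : (mfderiv 𝓘(ℂ, EuclideanSpace ℂ (Fin n)) 𝓘(ℂ, EuclideanSpace ℂ (Fin n))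
        φ.symm z : EuclideanSpace ℂ (Fin n) →L[ℂ] EuclideanSpace ℂ (Fin n)) =
        mfderiv 𝓘(ℂ, EuclideanSpace ℂ (Fin n)) 𝓘(ℂ, EuclideanSpace ℂ (Fin n))
        (ψ.symm ∘ (ψ ∘ φ.symm)) z := hev.mfderiv_eq
    have e2 := mfderiv_comp z h3 h4
    rw [mfderiv_eq_fderiv] at e2
    exact (DFunLike.congr_fun e1 u).trans (DFunLike.congr_fun e2 u)
  have cast : ∀ x y : X, x = y → ∀ u v u' v' : EuclideanSpace ℂ (Fin n), u = u' → v = v' →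
      Θ.metric x u v = Θ.metric y u' v' := by
    rintro x _ rfl u v _ _ rfl rfl
    rfl
  exact cast _ _ hx.symm _ _ _ _ (key u) (key v)

lemma volDensity_change [IsManifold 𝓘(ℂ, EuclideanSpace ℂ (Fin n)) ω X]
    {φ ψ : OpenPartialHomeomorph X (EuclideanSpace ℂ (Fin n))}
    (hφ : φ ∈ atlas (EuclideanSpace ℂ (Fin n)) X) (hψ : ψ ∈ atlas (EuclideanSpace ℂ (Fin n)) X)
    {z : EuclideanSpace ℂ (Fin n)} (hz : z ∈ φ.target) (hz' : φ.symm z ∈ ψ.source) :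
    ∃ T : EuclideanSpace ℂ (Fin n) →L[ℝ] EuclideanSpace ℂ (Fin n),
      HasFDerivAt (fun w => ψ (φ.symm w)) T z ∧
      Θ.volDensity φ z = |T.det| * Θ.volDensity ψ (ψ (φ.symm z)) := by
  obtain ⟨T, hT, hm⟩ := Θ.metric_change hφ hψ hz hz'
  refine ⟨T.restrictScalars ℝ, hT.restrictScalars ℝ, ?_⟩
  obtain ⟨b, hb⟩ := exists_basis n
  have hsm : ∀ (c : ℝ) (u : EuclideanSpace ℂ (Fin n)), chartVec ψ (ψ (φ.symm z)) (c • u) =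
      c • chartVec ψ (ψ (φ.symm z)) u := fun c u => by
    exact (chartVec ψ (ψ (φ.symm z))).map_smul (c : ℂ) u
  have hsm' : ∀ (c : ℝ) (u : TangentSpace 𝓘(ℂ, EuclideanSpace ℂ (Fin n))
      (ψ.symm (ψ (φ.symm z)))), Complex.I • c • u = c • Complex.I • u := fun c u =>
    smul_comm _ _ _
  let B : LinearMap.BilinForm ℝ (EuclideanSpace ℂ (Fin n)) :=
    LinearMap.mk₂ ℝ (fun u v => Θ.metric (ψ.symm (ψ (φ.symm z))) (chartVec ψ (ψ (φ.symm z)) u)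
      (chartVec ψ (ψ (φ.symm z)) v))
      (fun u u' v => by simp [metric]) (fun c u v => by simp [metric, hsm])
      (fun u v v' => by simp [metric]) (fun c u v => by simp [metric, hsm, hsm'])
  have e1 : Θ.volDensity ψ (ψ (φ.symm z)) = Real.sqrt (LinearMap.BilinForm.toMatrix b B).det := by
    rw [volDensity]
    congr 2
    ext i j
    rw [LinearMap.BilinForm.toMatrix_apply, hb]
    rfl
  have e2 : Θ.volDensity φ z = Real.sqrt (LinearMap.BilinForm.toMatrix b
      (B.comp (T.restrictScalars ℝ : _ →L[ℝ] _).toLinearMap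
        (T.restrictScalars ℝ : _ →L[ℝ] _).toLinearMap)).det := by
    rw [volDensity]
    congr 2
    ext i j
    rw [LinearMap.BilinForm.toMatrix_apply, hb]
    exact hm _ _
  rw [e1, e2, LinearMap.BilinForm.toMatrix_comp b b, Matrix.det_mul, Matrix.det_mul, Matrix.det_transpose,
    LinearMap.det_toMatrix, mul_right_comm, ← sq, Real.sqrt_mul (sq_nonneg _), Real.sqrt_sq_eq_abs]

lemma chartVol_eq [BorelSpace X] [IsManifold 𝓘(ℂ, EuclideanSpace ℂ (Fin n)) ω X]
    {φ ψ : OpenPartialHomeomorph X (EuclideanSpace ℂ (Fin n))}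
    (hφ : φ ∈ atlas (EuclideanSpace ℂ (Fin n)) X) (hψ : ψ ∈ atlas (EuclideanSpace ℂ (Fin n)) X)
    {A : Set X} (hA : MeasurableSet A) (hAφ : A ⊆ φ.source) (hAψ : A ⊆ ψ.source) :
    Θ.chartVol φ A = Θ.chartVol ψ A := by
  rw [chartVol_apply _ hA, chartVol_apply _ hA, inter_eq_left.2 hAφ, inter_eq_left.2 hAψ]
  have himg : ψ '' A = (fun w => ψ (φ.symm w)) '' (φ '' A) := by
    rw [image_image]
    exact image_congr fun x hx => by rw [φ.left_inv (hAφ hx)]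
  have hmem : ∀ z ∈ φ '' A, z ∈ φ.target ∧ φ.symm z ∈ A := by
    rintro _ ⟨x, hx, rfl⟩
    exact ⟨φ.map_source (hAφ hx), by rwa [φ.left_inv (hAφ hx)]⟩
  choose! T hT hd using fun z (hz : z ∈ φ '' A) =>
    Θ.volDensity_change hφ hψ (hmem z hz).1 (hAψ (hmem z hz).2)
  have hinj : InjOn (fun w => ψ (φ.symm w)) (φ '' A) := by
    intro z hz w hw hzw
    exact φ.symm.injOn (hmem z hz).1 (hmem w hw).1
      (ψ.injOn (hAψ (hmem z hz).2) (hAψ (hmem w hw).2) hzw)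
  have hms := measurableSet_chart_image hA hAφ
  rw [himg, lintegral_image_eq_lintegral_abs_det_fderiv_mul volume hms
    (fun z hz => (hT z hz).hasFDerivWithinAt) hinj]
  refine setLIntegral_congr_fun hms fun z hz => ?_
  simp only [hd z hz, ENNReal.ofReal_mul (abs_nonneg _)]

/-- In the domain of every chart, the volume measure is given by the density `√(det g)`. -/
theorem vol_restrict_source [BorelSpace X] [SecondCountableTopology X]
    [IsManifold 𝓘(ℂ, EuclideanSpace ℂ (Fin n)) ω X]
    {φ : OpenPartialHomeomorph X (EuclideanSpace ℂ (Fin n))}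
    (hφ : φ ∈ atlas (EuclideanSpace ℂ (Fin n)) X) :
    Θ.vol.restrict φ.source = Θ.chartVol φ := by
  have hsupp : ∀ ψ : OpenPartialHomeomorph X (EuclideanSpace ℂ (Fin n)),
      ∀ A : Set X, MeasurableSet A → Θ.chartVol ψ A = Θ.chartVol ψ (A ∩ ψ.source) := by
    intro ψ A hA
    rw [chartVol_apply _ hA, chartVol_apply _ (hA.inter ψ.open_source.measurableSet),
      inter_assoc, inter_self]
  obtain ⟨t, htc, ht⟩ := TopologicalSpace.countable_cover_nhds
    (fun x : X => (chartAt (EuclideanSpace ℂ (Fin n)) x).open_source.mem_nhds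
      (mem_chart_source _ x))
  have : Countable t := htc
  -- a countable family of charts covering `X`, starting with `φ`
  obtain ⟨c, hc⟩ := exists_surjective_nat (Option t)
  let f : ℕ → OpenPartialHomeomorph X (EuclideanSpace ℂ (Fin n)) := fun i =>
    Nat.casesOn i φ fun k => (c k).elim φ fun x => chartAt _ (x : X)
  have hf : ∀ i, f i ∈ atlas (EuclideanSpace ℂ (Fin n)) X := by
    intro i
    rcases i with _ | k
    · exact hφ
    · rcases hk : c k with _ | x
      · simpa [f, hk] using hφ
      · simp [f, hk]
  have hcov : ⋃ i, (f i).source = univ := by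
    refine eq_univ_of_univ_subset (ht.symm.subset.trans (iUnion₂_subset fun x hx => ?_))
    obtain ⟨k, hk⟩ := hc (some ⟨x, hx⟩)
    refine subset_iUnion_of_subset (k + 1) ?_
    simp [f, hk]
  let D : ℕ → Set X := disjointed fun i => (f i).source
  have hDm : ∀ i, MeasurableSet (D i) :=
    fun i => .disjointed (fun i => (f i).open_source.measurableSet) i
  have hDd : Pairwise (Function.onFun Disjoint D) := disjoint_disjointed _
  have hDs : ∀ i, D i ⊆ (f i).source := fun i => disjointed_subset _ i
  have hDc : ⋃ i, D i = univ := by rw [iUnion_disjointed, hcov]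
  let ν : Measure X := Measure.sum fun i => (Θ.chartVol (f i)).restrict (D i)
  have hle : Θ.vol ≤ ν := by
    refine iSup₂_le fun ψ hψ => Measure.le_iff.2 fun A hA => ?_
    rw [hsupp ψ A hA, Measure.sum_apply _ hA]
    have hB := hA.inter ψ.open_source.measurableSet
    rw [← Measure.restrict_univ (μ := Θ.chartVol ψ), ← hDc,
      Measure.restrict_iUnion hDd hDm, Measure.sum_apply _ hB]
    refine ENNReal.tsum_le_tsum fun i => ?_
    rw [Measure.restrict_apply hB, Measure.restrict_apply hA,
      Θ.chartVol_eq hψ (hf i) (hB.inter (hDm i)) (fun x hx => hx.1.2) fun x hx => hDs i hx.2]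
    exact measure_mono fun x hx => ⟨hx.1.1, hx.2⟩
  refine Measure.ext fun A hA => ?_
  have hB := hA.inter φ.open_source.measurableSet
  rw [Measure.restrict_apply hA, hsupp φ A hA]
  refine le_antisymm ((hle _).trans ?_) ((le_iSup₂ (f := fun ψ _ => Θ.chartVol ψ) φ hφ) _)
  have h0 : D 0 = φ.source := disjointed_zero _
  rw [Measure.sum_apply _ hB, tsum_eq_single 0 fun i hi => ?_]
  · rw [Measure.restrict_apply hB]
    exact measure_mono inter_subset_left
  · rw [Measure.restrict_apply hB]
    have : A ∩ φ.source ∩ D i = ∅ := by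
      rw [← h0]
      exact eq_empty_of_forall_notMem fun x hx => (hDd hi).le_bot ⟨hx.2, hx.1.2⟩
    rw [this, measure_empty]

end HermitianForm

end Base

/-! ### Hermitian line bundles and their holomorphic sections -/

section Bundle

variable {n : ℕ} {X : Type*} [TopologicalSpace X] [ChartedSpace (EuclideanSpace ℂ (Fin n)) X]

variable (n) in
/-- A smooth Hermitian metric on the complex line bundle `L`. As usual in Mathlib, the inner
product is conjugate-linear in its first argument. -/
structure HermitianMetric (L : X → Type*) [TopologicalSpace (TotalSpace ℂ L)]
    [∀ x, AddCommGroup (L x)] [∀ x, Module ℂ (L x)] [∀ x, TopologicalSpace (L x)]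
    [FiberBundle ℂ L] [VectorBundle ℂ ℂ L] where
  /-- the inner product on each fibre -/
  inner (x : X) : L x →ₗ⋆[ℂ] L x →ₗ[ℂ] ℂ
  conj_symm : ∀ x u v, conj (inner x u v) = inner x v u
  positive : ∀ x v, v ≠ 0 → 0 < (inner x v v).re
  /-- the squared length of the frame `y ↦ e.symm y 1` of a local trivialization `e` is smooth -/
  smooth : ∀ (e : Trivialization ℂ (π ℂ L)) [MemTrivializationAtlas e],
    ContMDiffOn 𝓘(ℝ, EuclideanSpace ℂ (Fin n)) 𝓘(ℝ, ℝ) ∞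
      (fun y => (inner y (e.symm y 1) (e.symm y 1)).re) e.baseSet

variable {L : X → Type*} [TopologicalSpace (TotalSpace ℂ L)]
    [∀ x, AddCommGroup (L x)] [∀ x, Module ℂ (L x)] [∀ x, TopologicalSpace (L x)]
    [FiberBundle ℂ L] [VectorBundle ℂ ℂ L]

namespace HermitianMetric

variable (h : HermitianMetric n L)

/-- The length `|v|_h` of a vector in the fibre over `x`. -/
def norm (x : X) (v : L x) : ℝ := Real.sqrt (h.inner x v v).re

lemma inner_self_nonneg (x : X) (v : L x) : 0 ≤ (h.inner x v v).re := by
  by_cases hv : v = 0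
  · simp [hv]
  · exact (h.positive x v hv).le

lemma norm_nonneg (x : X) (v : L x) : 0 ≤ h.norm x v := Real.sqrt_nonneg _

/-- The inner product on a single fibre. -/
@[reducible]
def core (x : X) : PreInnerProductSpace.Core ℂ (L x) where
  inner u v := h.inner x u v
  conj_inner_symm u v := h.conj_symm x v u
  re_inner_nonneg v := h.inner_self_nonneg x v
  add_left u v w := by simp
  smul_left u v r := by simp

lemma norm_add_le (x : X) (u v : L x) : h.norm x (u + v) ≤ h.norm x u + h.norm x v := by
  let _ : PreInnerProductSpace.Core ℂ (L x) := h.core x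
  let _ : SeminormedAddCommGroup (L x) :=
    InnerProductSpace.Core.toSeminormedAddCommGroup (𝕜 := ℂ)
  exact (InnerProductSpace.Core.toSeminormedSpaceCore (h.core x)).norm_triangle u v

lemma norm_smul (x : X) (c : ℂ) (v : L x) : h.norm x (c • v) = ‖c‖ * h.norm x v := by
  let _ : PreInnerProductSpace.Core ℂ (L x) := h.core x
  let _ : SeminormedAddCommGroup (L x) :=
    InnerProductSpace.Core.toSeminormedAddCommGroup (𝕜 := ℂ)
  exact (InnerProductSpace.Core.toSeminormedSpaceCore (h.core x)).norm_smul c v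

lemma norm_inner_le (x : X) (u v : L x) : ‖h.inner x u v‖ ≤ h.norm x u * h.norm x v := by
  let _ : PreInnerProductSpace.Core ℂ (L x) := h.core x
  exact InnerProductSpace.Core.norm_inner_le_norm (𝕜 := ℂ) u v

lemma sq_norm (x : X) (v : L x) : h.norm x v ^ 2 = (h.inner x v v).re :=
  Real.sq_sqrt (h.inner_self_nonneg x v)

end HermitianMetric

variable (n L) in
/-- The holomorphic (i.e. complex differentiable) sections of `L`, as a subspace of the space
of all sections. -/
def holSubmodule [ContMDiffVectorBundle ω ℂ L 𝓘(ℂ, EuclideanSpace ℂ (Fin n))] :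
    Submodule ℂ (∀ x, L x) where
  carrier := {s | MDifferentiable 𝓘(ℂ, EuclideanSpace ℂ (Fin n))
    (𝓘(ℂ, EuclideanSpace ℂ (Fin n)).prod 𝓘(ℂ, ℂ)) fun x => TotalSpace.mk' ℂ x (s x)}
  add_mem' hs ht := mdifferentiable_add_section hs ht
  zero_mem' := mdifferentiable_zeroSection ℂ L
  smul_mem' _ _ hs x := (hs x).smul_const_section

variable [ContMDiffVectorBundle ω ℂ L 𝓘(ℂ, EuclideanSpace ℂ (Fin n))]

/-- The space `H⁰(X, L)` of holomorphic sections of `L`; the metric `h` is recorded because it is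
used to describe the topology. -/
def HolSection (_h : HermitianMetric n L) : Type _ := ↥(holSubmodule n L)

namespace HolSection

variable {h : HermitianMetric n L}

instance : AddCommGroup (HolSection h) := inferInstanceAs (AddCommGroup ↥(holSubmodule n L))

instance : Module ℂ (HolSection h) := inferInstanceAs (Module ℂ ↥(holSubmodule n L))

/-- The value of a holomorphic section at a point. -/
def toSection (s : HolSection h) : ∀ x, L x := Subtype.val (p := (· ∈ holSubmodule n L)) s

instance : CoeFun (HolSection h) (fun _ => ∀ x, L x) := ⟨toSection⟩

lemma add_apply (s t : HolSection h) (x : X) : (s + t) x = s x + t x := rfl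

lemma smul_apply (c : ℂ) (s : HolSection h) (x : X) : (c • s) x = c • s x := rfl

lemma eq_smul_frame (s : HolSection h) (x₀ x : X)
    (hx : x ∈ (trivializationAt ℂ L x₀).baseSet) :
    s x = (trivializationAt ℂ L x₀ ⟨x, s x⟩).2 • (trivializationAt ℂ L x₀).symm x 1 := by
  have h1 := (trivializationAt ℂ L x₀).symm_apply_apply_mk hx (s x)
  have h2 : ∀ c : ℂ, (trivializationAt ℂ L x₀).symm x c
      = c • (trivializationAt ℂ L x₀).symm x 1 := fun c => by
    have h3 := Trivialization.coe_symmₗ (R := ℂ) (trivializationAt ℂ L x₀) hx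
    rw [← h3, ← map_smul, smul_eq_mul, mul_one]
  rw [← h2, h1]

lemma continuous_inner (s t : HolSection h) : Continuous fun x => h.inner x (s x) (t x) := by
  rw [continuous_iff_continuousAt]
  intro x₀
  have hc : ∀ s : HolSection h,
      ContinuousAt (fun x => (trivializationAt ℂ L x₀ ⟨x, s x⟩).2) x₀ := fun s =>
    ((mdifferentiableAt_section 𝓘(ℂ, EuclideanSpace ℂ (Fin n)) (F := ℂ) s.toSection).1
      (s.2 x₀)).continuousAt
  have hbase : (trivializationAt ℂ L x₀).baseSet ∈ 𝓝 x₀ :=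
    (trivializationAt ℂ L x₀).open_baseSet.mem_nhds (mem_baseSet_trivializationAt ℂ L x₀)
  have hh : ContinuousAt (fun y => (h.inner y ((trivializationAt ℂ L x₀).symm y 1)
      ((trivializationAt ℂ L x₀).symm y 1)).re) x₀ :=
    (h.smooth (trivializationAt ℂ L x₀)).continuousOn.continuousAt hbase
  have key : ContinuousAt (fun x => conj (trivializationAt ℂ L x₀ ⟨x, s x⟩).2 *
      ((trivializationAt ℂ L x₀ ⟨x, t x⟩).2 *
        (((h.inner x ((trivializationAt ℂ L x₀).symm x 1)
          ((trivializationAt ℂ L x₀).symm x 1)).re : ℝ) : ℂ))) x₀ :=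
    (Complex.continuous_conj.continuousAt.comp (hc s)).mul
      ((hc t).mul (Complex.continuous_ofReal.continuousAt.comp hh))
  refine key.congr ?_
  filter_upwards [hbase] with x hx
  rw [Complex.conj_eq_iff_re.1 (h.conj_symm x _ _)]
  conv_rhs => rw [s.eq_smul_frame x₀ x hx, t.eq_smul_frame x₀ x hx]
  simp only [map_smulₛₗ, LinearMap.smul_apply, smul_eq_mul, RingHom.id_apply]
  ring

lemma continuous_norm (s : HolSection h) : Continuous fun x => h.norm x (s x) :=
  (Complex.continuous_re.comp (s.continuous_inner s)).sqrt

lemma bddAbove_norm (s : HolSection h) (K : TopologicalSpace.Compacts X) :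
    BddAbove (range fun x : K => h.norm x (s x)) := by
  have := K.isCompact.bddAbove_image s.continuous_norm.continuousOn
  rwa [image_eq_range] at this

variable (h) in
/-- The seminorm `s ↦ sup_{x ∈ K} |s(x)|_h` on `H⁰(X, L)`, for `K ⊆ X` compact. -/
def supSeminorm (K : TopologicalSpace.Compacts X) : Seminorm ℂ (HolSection h) :=
  Seminorm.of (fun s => ⨆ x : K, h.norm x (s x))
    (fun s t => by
      refine Real.iSup_le (fun x => ?_) (add_nonneg
        (Real.iSup_nonneg fun _ => h.norm_nonneg _ _) (Real.iSup_nonneg fun _ => h.norm_nonneg _ _))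
      exact (h.norm_add_le _ _ _).trans
        (add_le_add (le_ciSup (s.bddAbove_norm K) x) (le_ciSup (t.bddAbove_norm K) x)))
    (fun c s => by
      simp only [smul_apply, h.norm_smul]
      exact (Real.mul_iSup_of_nonneg (_root_.norm_nonneg c) _).symm)

/-- The topology of uniform convergence on compact sets, given by the seminorms `supSeminorm`. -/
instance : TopologicalSpace (HolSection h) :=
  (SeminormFamily.moduleFilterBasis (𝕜 := ℂ) (supSeminorm h)).topology

lemma withSeminorms : WithSeminorms (𝕜 := ℂ) (supSeminorm h) := ⟨rfl⟩

/-- The Borel `σ`-algebra of `H⁰(X, L)`. -/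
instance : MeasurableSpace (HolSection h) := borel _

instance : BorelSpace (HolSection h) := ⟨rfl⟩

/-- Locally uniform convergence (uniform convergence on every compact set) of a sequence of
sections. -/
def ConvergesLocallyUniformly (F : ℕ → HolSection h) (s : HolSection h) : Prop :=
  ∀ K : Set X, IsCompact K → ∀ ε > 0, ∀ᶠ N in atTop, ∀ x ∈ K, h.norm x (F N x - s x) < ε

end HolSection

/-! ### Square integrable holomorphic sections -/

section L2

variable [MeasurableSpace X] [BorelSpace X]

lemma integrable_inner {Θ : HermitianForm n X} {h : HermitianMetric n L} {s t : HolSection h}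
    (hs : Integrable (fun x => h.norm x (s x) ^ 2) Θ.vol)
    (ht : Integrable (fun x => h.norm x (t x) ^ 2) Θ.vol) :
    Integrable (fun x => h.inner x (s x) (t x)) Θ.vol := by
  refine (hs.add ht).mono' (s.continuous_inner t).aestronglyMeasurable (.of_forall fun x => ?_)
  have := h.norm_inner_le x (s x) (t x)
  simp only [Pi.add_apply]
  nlinarith [sq_nonneg (h.norm x (s x) - h.norm x (t x)), sq_nonneg (h.norm x (s x)),
    sq_nonneg (h.norm x (t x))]

/-- The holomorphic sections `s` with `∫ |s|²_h dV < ∞`, as a subspace of `H⁰(X, L)`. -/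
def l2Submodule (Θ : HermitianForm n X) (h : HermitianMetric n L) :
    Submodule ℂ (HolSection h) where
  carrier := {s | Integrable (fun x => h.norm x (s x) ^ 2) Θ.vol}
  add_mem' {s t} hs ht := by
    refine ((hs.add ht).const_mul 2).mono' ((s + t).continuous_norm.pow 2).aestronglyMeasurable
      (.of_forall fun x => ?_)
    have h1 := h.norm_add_le x (s x) (t x)
    have h2 := h.norm_nonneg x (s x + t x)
    rw [HolSection.add_apply, Real.norm_of_nonneg (sq_nonneg _)]
    simp only [Pi.add_apply]
    nlinarith [sq_nonneg (h.norm x (s x) - h.norm x (t x))]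
  zero_mem' := by
    have : ∀ x, h.norm x ((0 : HolSection h) x) ^ 2 = 0 := fun x => by
      rw [h.sq_norm]
      change (h.inner x 0 0).re = 0
      simp
    simp only [mem_ofPred_eq, this]
    exact integrable_zero _ _ _
  smul_mem' c s hs := by
    simp only [mem_ofPred_eq, HolSection.smul_apply, h.norm_smul, mul_pow] at hs ⊢
    exact hs.const_mul _

/-- The space `H⁰₍₂₎(X, L)` of square integrable holomorphic sections. -/
def L2HolSection (Θ : HermitianForm n X) (h : HermitianMetric n L) : Type _ :=
  ↥(l2Submodule Θ h)

namespace L2HolSection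

variable {Θ : HermitianForm n X} {h : HermitianMetric n L}

instance : AddCommGroup (L2HolSection Θ h) := inferInstanceAs (AddCommGroup ↥(l2Submodule Θ h))

instance : Module ℂ (L2HolSection Θ h) := inferInstanceAs (Module ℂ ↥(l2Submodule Θ h))

/-- The underlying holomorphic section. -/
def toHol (s : L2HolSection Θ h) : HolSection h := Subtype.val (p := (· ∈ l2Submodule Θ h)) s

variable (Θ h) in
/-- The inner product `⟨s, t⟩ = ∫ ⟨s(x), t(x)⟩_h dV(x)`. -/
@[reducible]
def core : PreInnerProductSpace.Core ℂ (L2HolSection Θ h) where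
  inner s t := ∫ x, h.inner x (s.toHol x) (t.toHol x) ∂Θ.vol
  conj_inner_symm s t := by
    rw [← integral_conj]
    exact integral_congr_ae (.of_forall fun x => h.conj_symm x _ _)
  re_inner_nonneg s := by
    have h1 : ∫ x, h.inner x (s.toHol x) (s.toHol x) ∂Θ.vol
        = ((∫ x, h.norm x (s.toHol x) ^ 2 ∂Θ.vol : ℝ) : ℂ) := by
      rw [← integral_complex_ofReal]
      refine integral_congr_ae (.of_forall fun x => ?_)
      simp only [h.sq_norm]
      exact (Complex.conj_eq_iff_re.1 (h.conj_symm x _ _)).symm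
    rw [h1]
    simpa using integral_nonneg fun x => sq_nonneg (h.norm x (s.toHol x))
  add_left s t u := by
    refine Eq.trans ?_ (integral_add (integrable_inner s.2 u.2) (integrable_inner t.2 u.2))
    refine integral_congr_ae (.of_forall fun x => ?_)
    change h.inner x (s.toHol x + t.toHol x) _ = _
    simp
  smul_left s t c := by
    rw [← integral_const_mul]
    refine integral_congr_ae (.of_forall fun x => ?_)
    change h.inner x (c • s.toHol x) _ = _
    simp

instance : SeminormedAddCommGroup (L2HolSection Θ h) :=
  @InnerProductSpace.Core.toSeminormedAddCommGroup ℂ _ _ _ _ (core Θ h)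

instance : InnerProductSpace ℂ (L2HolSection Θ h) :=
  InnerProductSpace.ofCore (core Θ h)

variable (Θ h) in
/-- An orthonormal (Hilbert) basis of `H⁰₍₂₎(X, L)`: an orthonormal family whose linear span
is dense for the `L²` norm. -/
structure IsOrthonormalBasis {ι : Type*} (S : ι → L2HolSection Θ h) : Prop where
  orthonormal : Orthonormal ℂ S
  dense : Dense (Submodule.span ℂ (range S) : Set (L2HolSection Θ h))

end L2HolSection

end L2
end Bundle

/-! ### Random holomorphic sections -/

/-- The index set `{j : j < d}` of an orthonormal basis `S_0, S_1, …` of a Hilbert space of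
dimension `d ∈ ℕ ∪ {∞}`. -/
abbrev BasisIndex (d : ℕ∞) : Type := {j : ℕ // (j : ℕ∞) < d}

section Random

variable {Ω ι : Type*} [MeasurableSpace Ω]

/-- Independent, identically distributed, centered Gaussian random variables with values in
`ℂ = ℝ²`. Real Gaussian variables are the case of a law carried by `ℝ ⊆ ℂ`. -/
structure IsIIDCenteredGaussian (η : ι → Ω → ℂ) (P : Measure Ω) : Prop where
  gaussian : ∀ j, HasGaussianLaw (η j) P
  centered : ∀ j, ∫ w, η j w ∂P = 0
  identDistrib : ∀ i j, IdentDistrib (η i) (η j) P P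
  indep : iIndepFun η P

/-- The standard complex Gaussian law: the law of `(U + i V) / √2` for independent standard real
Gaussian variables `U`, `V`. -/
def stdComplexGaussian : Measure ℂ :=
  ((gaussianReal 0 1).prod (gaussianReal 0 1)).map
    fun p : ℝ × ℝ => ((p.1 : ℂ) + Complex.I * (p.2 : ℂ)) / (Real.sqrt 2 : ℂ)

/-- Independent standard complex Gaussian random variables. -/
structure IsIIDStdComplexGaussian (η : ι → Ω → ℂ) (P : Measure Ω) : Prop where
  law : ∀ j, HasLaw (η j) stdComplexGaussian P
  indep : iIndepFun η P

end Random

section PartialSum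

variable {n : ℕ} {X : Type*} [TopologicalSpace X] [ChartedSpace (EuclideanSpace ℂ (Fin n)) X]
  [MeasurableSpace X] [BorelSpace X]
  {L : X → Type*} [TopologicalSpace (TotalSpace ℂ L)]
  [∀ x, AddCommGroup (L x)] [∀ x, Module ℂ (L x)] [∀ x, TopologicalSpace (L x)]
  [FiberBundle ℂ L] [VectorBundle ℂ ℂ L]
  [ContMDiffVectorBundle ω ℂ L 𝓘(ℂ, EuclideanSpace ℂ (Fin n))]
  {Θ : HermitianForm n X} {h : HermitianMetric n L}

/-- The partial sum `∑ c_j S_j` over all indices `j < N` (and `j < d`). -/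
def partialSum {d : ℕ∞} (S : BasisIndex d → L2HolSection Θ h) (c : BasisIndex d → ℂ) (N : ℕ) :
    HolSection h :=
  ∑ j ∈ Finset.range N, if hj : (j : ℕ∞) < d then c ⟨j, hj⟩ • (S ⟨j, hj⟩).toHol else 0

/-- The random section `ψ` is the sum of the series `∑ η_j S_j`: almost surely, the partial sums
converge to `ψ` locally uniformly on `X`. -/
def IsGaussianSeries {Ω : Type*} [MeasurableSpace Ω] (P : Measure Ω) {d : ℕ∞}
    (S : BasisIndex d → L2HolSection Θ h) (η : BasisIndex d → Ω → ℂ) (ψ : Ω → HolSection h) :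
    Prop :=
  ∀ᵐ w ∂P, HolSection.ConvergesLocallyUniformly (partialSum S fun j => η j w) (ψ w)

end PartialSum

end GaussSec

end

/-! Everything rests on local bounds for point evaluations on H⁰₍₂₎. In a chart and a frame of L a
section becomes a holomorphic function f of n variables, and |f|² satisfies a mean value inequality
over balls (`enorm_sq_mul_volume_le`). On a compact ball the length of the frame and the volume
density are bounded below by positive constants, so |f(z)| ≤ C‖s‖ locally uniformly in z
(`exists_norm_coord_le`). Bessel's inequality for the evaluation functionals then bounds the Bergman
sums ∑|S_j(z)|² by C², and integration over a ball gives ∑‖S_j‖² < ∞ for the local L² norms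
(`summable_sq_norm_toL2`).

Convergence: in an inner product space, a series ∑ η_j v_j with independent centered η_j of common
variance and ∑‖v_j‖² < ∞ is almost surely Cauchy, by Kolmogorov's maximal inequality
(`ae_cauchySeq_sum_smul`). This is applied in the local L² spaces of countably many balls whose
halves cover X. The mean value inequality turns L²-Cauchy on a ball into uniformly Cauchy on the
half ball (`exists_norm_res_le_norm_toL2`), and H⁰ is complete by Weierstrass' theorem
(`exists_tendsto_of_cauchySeq_res`). Of the Gaussian law only the finite second moment is used here.

Uniqueness of the law: for a continuous functional l on H⁰ that is bounded on H⁰₍₂₎, the expectation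
of exp(i Re l(ψ)) is exp(-¼ ∑|l(S_j)|²), and the sum is the squared norm of l on H⁰₍₂₎ for every
orthonormal basis (`tsum_sq_norm_apply_eq`). The topology of H⁰ is induced from a countable product
of separable Banach spaces of continuous functions on balls (`isInducing_resFamily`). On that
product the characteristic functionals of finite marginals determine a law, and the Borel sets of H⁰
are the preimages of Borel sets of the product. Completeness of H⁰₍₂₎ plays no role. -/

noncomputable section

set_option linter.unusedSectionVars false

namespace GaussSec

/-! ### Holomorphic functions of several variables: mean value inequality, Cauchy estimate,
Weierstrass' theorem -/

section SeveralVariables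

variable {n : ℕ}

/-- Multiplication by a complex number of modulus one preserves Lebesgue measure. -/
lemma measurePreserving_smul_circle {c : ℂ} (hc : ‖c‖ = 1) :
    MeasurePreserving (fun w : EuclideanSpace ℂ (Fin n) => c • w) volume volume := by
  have hc0 : c ≠ 0 := by
    rintro rfl
    simp at hc
  let e : EuclideanSpace ℂ (Fin n) ≃ₗᵢ[ℂ] EuclideanSpace ℂ (Fin n) :=
    { LinearEquiv.smulOfNeZero ℂ _ c hc0 with
      norm_map' := fun w => by
        change ‖c • w‖ = ‖w‖
        rw [norm_smul, hc, one_mul] }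
  let e' : EuclideanSpace ℂ (Fin n) ≃ₗᵢ[ℝ] EuclideanSpace ℂ (Fin n) :=
    { e.toLinearEquiv.restrictScalars ℝ with
      norm_map' := e.norm_map }
  exact e'.measurePreserving

/-- The square f² is holomorphic, so f(0)² is its average over the unit circle; taking absolute
values inside the integral gives the bound. -/
lemma enorm_sq_le_lintegral_circle {f : ℂ → ℂ} {U : Set ℂ}
    (hf : DifferentiableOn ℂ f U) (hb : Metric.closedBall 0 1 ⊆ U) :
    ENNReal.ofReal (2 * Real.pi) * ‖f 0‖ₑ ^ 2 ≤
      ∫⁻ θ in Ioc 0 (2 * Real.pi), ‖f (circleMap 0 1 θ)‖ₑ ^ 2 := by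
  have h1 : DiffContOnCl ℂ (fun z => f z ^ 2) (Metric.ball 0 |1|) := by
    rw [abs_one]
    refine ((hf.pow 2).mono ?_).diffContOnCl
    rwa [closure_ball _ one_ne_zero]
  have h2 := h1.circleAverage
  have hpi : 0 < 2 * Real.pi := by positivity
  rw [Real.circleAverage, intervalIntegral.integral_of_le hpi.le] at h2
  have h3 : ((2 * Real.pi : ℝ) : ℂ) * f 0 ^ 2 =
      ∫ θ in Ioc 0 (2 * Real.pi), f (circleMap 0 1 θ) ^ 2 := by
    rw [← h2, Complex.real_smul, ← mul_assoc, ← Complex.ofReal_mul, mul_inv_cancel₀ hpi.ne',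
      Complex.ofReal_one, one_mul]
  have h4 := enorm_integral_le_lintegral_enorm (μ := volume.restrict (Ioc 0 (2 * Real.pi)))
    (fun θ => f (circleMap 0 1 θ) ^ 2)
  rw [← h3] at h4
  simp only [enorm_mul, enorm_pow] at h4
  convert h4 using 2
  rw [← ofReal_norm, Complex.norm_real, Real.norm_of_nonneg hpi.le]

/-- The mean value inequality for the squared modulus of a holomorphic function. -/
theorem enorm_sq_mul_volume_le {f : EuclideanSpace ℂ (Fin n) → ℂ}
    {U : Set (EuclideanSpace ℂ (Fin n))} (hf : DifferentiableOn ℂ f U)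
    {z : EuclideanSpace ℂ (Fin n)} {r : ℝ} (hb : Metric.closedBall z r ⊆ U) :
    ‖f z‖ₑ ^ 2 * volume (Metric.closedBall (0 : EuclideanSpace ℂ (Fin n)) r) ≤
      ∫⁻ w in Metric.closedBall z r, ‖f w‖ₑ ^ 2 := by
  set B := Metric.closedBall (0 : EuclideanSpace ℂ (Fin n)) r with hB
  have hBm : MeasurableSet B := Metric.isClosed_closedBall.measurableSet
  have hmem : ∀ w ∈ B, z + w ∈ U := fun w hw => hb (by simpa [hB] using hw)
  -- Extension by zero: the ball is invariant under rotation by unit scalars, so the integrals over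
  -- it can be taken over the whole space, where rotations preserve the measure.
  let F : EuclideanSpace ℂ (Fin n) → ℝ≥0∞ := B.indicator fun w => ‖f (z + w)‖ₑ ^ 2
  have hcont : ContinuousOn (fun w => f (z + w)) B :=
    hf.continuousOn.comp (by fun_prop) hmem
  have hF : Measurable F := by
    classical
    have hp := (ENNReal.continuous_pow 2).comp_continuousOn
      (continuous_enorm.comp_continuousOn hcont)
    have := hp.measurable_piecewise (g := 0) continuousOn_const hBm
    rwa [piecewise_eq_indicator] at this
  have hpi : 0 < 2 * Real.pi := by positivity
  -- One-variable inequality on the disc ζ ↦ z + ζw. It is next integrated over w; after Fubini, the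
  -- w-integral is the same for every angle and 2π cancels.
  have hpt : ∀ w ∈ B, ENNReal.ofReal (2 * Real.pi) * ‖f z‖ₑ ^ 2 ≤
      ∫⁻ θ in Ioc 0 (2 * Real.pi), F (circleMap 0 1 θ • w) := by
    intro w hw
    have hl : Differentiable ℂ fun ζ : ℂ => z + ζ • w := by fun_prop
    have hc : ∀ ζ : ℂ, ‖ζ‖ ≤ 1 → ζ • w ∈ B := fun ζ hζ => by
      simp only [hB, mem_closedBall_zero_iff] at hw ⊢
      rw [norm_smul]
      nlinarith [norm_nonneg w]
    have := enorm_sq_le_lintegral_circle (f := fun ζ : ℂ => f (z + ζ • w))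
      (hf.comp hl.differentiableOn fun _ h => h)
      (fun ζ hζ => hmem _ (hc ζ (by simpa using hζ)))
    simp only [zero_smul, add_zero] at this
    refine this.trans_eq (lintegral_congr fun θ => ?_)
    exact (indicator_of_mem (hc _ (by simp)) fun w => ‖f (z + w)‖ₑ ^ 2).symm
  have hle : ∫⁻ _ in B, ENNReal.ofReal (2 * Real.pi) * ‖f z‖ₑ ^ 2 ≤
      ∫⁻ w, ∫⁻ θ in Ioc 0 (2 * Real.pi), F (circleMap 0 1 θ • w) := by
    refine (setLIntegral_mono' hBm hpt).trans (setLIntegral_le_lintegral _ _)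
  have hjm : Measurable fun p : EuclideanSpace ℂ (Fin n) × ℝ => F (circleMap 0 1 p.2 • p.1) :=
    hF.comp (by fun_prop)
  rw [setLIntegral_const, lintegral_lintegral_swap hjm.aemeasurable] at hle
  have hrot : ∀ θ, ∫⁻ w, F (circleMap 0 1 θ • w) = ∫⁻ w, F w := fun θ =>
    (measurePreserving_smul_circle (by simp)).lintegral_comp hF
  simp only [hrot, setLIntegral_const, Real.volume_Ioc, sub_zero] at hle
  rw [mul_assoc, mul_comm (∫⁻ w, F w)] at hle
  have h0 : ENNReal.ofReal (2 * Real.pi) ≠ 0 := by simpa using hpi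
  rw [ENNReal.mul_le_mul_iff_right h0 ENNReal.ofReal_ne_top] at hle
  refine hle.trans_eq ?_
  rw [lintegral_indicator hBm]
  have hpre : B = (fun w => z + w) ⁻¹' Metric.closedBall z r := by
    ext w
    simp [hB]
  rw [hpre]
  exact (measurePreserving_add_left volume z).setLIntegral_comp_preimage_emb
    (measurableEmbedding_addLeft z) (fun w => ‖f w‖ₑ ^ 2) _

/-- Cauchy's estimate for the differential. -/
lemma norm_fderiv_le_of_forall_norm_le {f : EuclideanSpace ℂ (Fin n) → ℂ}
    {z : EuclideanSpace ℂ (Fin n)} {r C : ℝ} (hr : 0 < r) (hC : 0 ≤ C)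
    (hf : DifferentiableOn ℂ f (Metric.ball z r)) (hfC : ∀ w ∈ Metric.ball z r, ‖f w‖ ≤ C) :
    ‖fderiv ℂ f z‖ ≤ 2 * C / r := by
  refine ContinuousLinearMap.opNorm_le_bound _ (by positivity) fun v => ?_
  rcases eq_or_ne v 0 with rfl | hv
  · simp
  have hv' : 0 < ‖v‖ := norm_pos_iff.2 hv
  -- With half of the largest radius, the closed disc stays in the open ball; this is the origin of
  -- the factor 2 in the bound.
  set ρ := r / (2 * ‖v‖) with hρ
  have hρ0 : 0 < ρ := by positivity
  have hmem : ∀ ζ ∈ Metric.closedBall (0 : ℂ) ρ, z + ζ • v ∈ Metric.ball z r := fun ζ hζ => by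
    rw [mem_closedBall_zero_iff] at hζ
    rw [mem_ball_iff_norm, add_sub_cancel_left, norm_smul]
    calc ‖ζ‖ * ‖v‖ ≤ ρ * ‖v‖ := by gcongr
      _ = r / 2 := by rw [hρ]; field_simp
      _ < r := by linarith
  have hl : Differentiable ℂ fun ζ : ℂ => z + ζ • v := by fun_prop
  have hd : DiffContOnCl ℂ (fun ζ : ℂ => f (z + ζ • v)) (Metric.ball 0 ρ) := by
    refine DifferentiableOn.diffContOnCl ?_
    rw [closure_ball _ hρ0.ne']
    exact hf.comp hl.differentiableOn hmem
  have h1 := Complex.norm_deriv_le_of_forall_mem_sphere_norm_le hρ0 hd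
    (fun ζ hζ => hfC _ (hmem ζ (Metric.sphere_subset_closedBall hζ)))
  have h2 : HasDerivAt (fun ζ : ℂ => f (z + ζ • v)) (fderiv ℂ f z v) 0 := by
    have hfz : HasFDerivAt f (fderiv ℂ f z) (z + (0 : ℂ) • v) := by
      rw [zero_smul, add_zero]
      exact (hf.differentiableAt (Metric.ball_mem_nhds z hr)).hasFDerivAt
    have h3 : HasDerivAt (fun ζ : ℂ => z + ζ • v) v 0 := by
      simpa using ((hasDerivAt_id (0 : ℂ)).smul_const v).const_add z
    exact hfz.comp_hasDerivAt _ h3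
  rw [h2.deriv] at h1
  refine h1.trans_eq ?_
  rw [hρ]
  field_simp

/-- A locally uniform limit of holomorphic functions of several variables is holomorphic. -/
theorem differentiableOn_of_tendstoUniformlyOn {f : ℕ → EuclideanSpace ℂ (Fin n) → ℂ}
    {g : EuclideanSpace ℂ (Fin n) → ℂ} {U : Set (EuclideanSpace ℂ (Fin n))} (hU : IsOpen U)
    (hf : ∀ N, DifferentiableOn ℂ (f N) U) (hfg : TendstoUniformlyOn f g atTop U) :
    DifferentiableOn ℂ g U := by
  intro z hz
  obtain ⟨r, hr, hrU⟩ := Metric.isOpen_iff.1 hU z hz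
  have hsub : ∀ w ∈ Metric.ball z (r / 2), Metric.ball w (r / 2) ⊆ U := fun w hw =>
    (Metric.ball_subset_ball' (by rw [Metric.mem_ball] at hw; linarith)).trans hrU
  have hc : UniformCauchySeqOn (fun N => fderiv ℂ (f N)) atTop (Metric.ball z (r / 2)) := by
    rw [Metric.uniformCauchySeqOn_iff]
    intro ε hε
    -- Cauchy's estimate on balls of radius r/2 turns εr/8 into 2(εr/8)/(r/2) = ε/2 for the
    -- differentials.
    obtain ⟨N₀, hN₀⟩ := Metric.uniformCauchySeqOn_iff.1 hfg.uniformCauchySeqOn (ε * r / 8)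
      (by positivity)
    refine ⟨N₀, fun m hm k hk w hw => ?_⟩
    have hd : ∀ N, DifferentiableAt ℂ (f N) w := fun N =>
      (hf N).differentiableAt (hU.mem_nhds (hsub w hw (Metric.mem_ball_self (by positivity))))
    have := norm_fderiv_le_of_forall_norm_le (f := fun y => f m y - f k y) (z := w)
      (r := r / 2) (C := ε * r / 8) (by positivity) (by positivity)
      (((hf m).mono (hsub w hw)).sub ((hf k).mono (hsub w hw)))
      (fun y hy => by
        rw [← dist_eq_norm]
        exact (hN₀ m hm k hk y (hsub w hw hy)).le)
    rw [fderiv_fun_sub (hd m) (hd k)] at this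
    rw [dist_eq_norm]
    refine this.trans_lt ?_
    field_simp
    linarith
  have hlim : ∀ w ∈ Metric.ball z (r / 2), ∃ T, Tendsto (fun N => fderiv ℂ (f N) w) atTop (𝓝 T) :=
    fun w hw => cauchySeq_tendsto_of_complete (hc.cauchySeq hw)
  choose! g' hg' using hlim
  have hzz : z ∈ Metric.ball z (r / 2) := Metric.mem_ball_self (by positivity)
  refine (hasFDerivAt_of_tendstoUniformlyOn (f := f) Metric.isOpen_ball
    (hc.tendstoUniformlyOn_of_tendsto hg') (fun N w hw => ?_) (fun w hw => ?_)
      hzz).differentiableAt.differentiableWithinAt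
  · exact ((hf N).differentiableAt (hU.mem_nhds
      (hsub w hw (Metric.mem_ball_self (by positivity))))).hasFDerivAt
  · exact hfg.tendsto_at (hsub w hw (Metric.mem_ball_self (by positivity)))

end SeveralVariables

/-! ### Random series in inner product spaces: Kolmogorov's inequality and almost sure convergence
-/

section RandomSeries

variable {E Ω : Type*} [NormedAddCommGroup E] [InnerProductSpace ℂ E] [MeasurableSpace Ω]
  {P : Measure Ω} {η : ℕ → Ω → ℂ}

/-- The terms with indices 0, …, N are exactly what the natural filtration knows at time N; hence
the shift by one in the sums throughout this part. -/
lemma stronglyMeasurable_sum_smul_natural (hm : ∀ j, StronglyMeasurable (η j)) (v : ℕ → E) (N : ℕ) :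
    StronglyMeasurable[Filtration.natural η hm N]
      fun w => ∑ j ∈ Finset.range (N + 1), η j w • v j := by
  refine Finset.stronglyMeasurable_fun_sum _ fun j hj => ?_
  have h1 := (Filtration.stronglyAdapted_natural hm j).mono
    ((Filtration.natural η hm).mono (Nat.lt_succ_iff.1 (Finset.mem_range.1 hj)))
  exact h1.smul_const (v j)

lemma memLp_sum_smul (hL : ∀ j, MemLp (η j) 2 P) (v : ℕ → E) (N : ℕ) :
    MemLp (fun w => ∑ j ∈ Finset.range N, η j w • v j) 2 P := by
  refine memLp_finsetSum _ fun j _ => ?_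
  exact (ContinuousLinearMap.toSpanSingleton ℂ (v j)).comp_memLp' (hL j)

/-- Orthogonality of the increments of a sum of independent centered random vectors. -/
lemma setIntegral_sq_norm_sum_succ [IsProbabilityMeasure P] (hm : ∀ j, StronglyMeasurable (η j))
    (hL : ∀ j, MemLp (η j) 2 P) (h0 : ∀ j, ∫ w, η j w ∂P = 0) (hi : iIndepFun η P) (v : ℕ → E)
    (N : ℕ) {s : Set Ω} (hs : MeasurableSet[Filtration.natural η hm N] s) :
    ∫ w in s, ‖∑ j ∈ Finset.range (N + 2), η j w • v j‖ ^ 2 ∂P =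
      ∫ w in s, ‖∑ j ∈ Finset.range (N + 1), η j w • v j‖ ^ 2 ∂P +
        ∫ w in s, ‖η (N + 1) w • v (N + 1)‖ ^ 2 ∂P := by
  have hs' : MeasurableSet s := (Filtration.natural η hm).le N s hs
  -- The cross term in the expansion of the square is 2 Re(η_{N+1} c). Since c is measurable at time
  -- N, it is independent of η_{N+1}, which has mean zero.
  let c : Ω → ℂ := s.indicator fun w =>
    inner ℂ (∑ j ∈ Finset.range (N + 1), η j w • v j) (v (N + 1))
  have hcm : StronglyMeasurable[Filtration.natural η hm N] c :=
    ((stronglyMeasurable_sum_smul_natural hm v N).inner stronglyMeasurable_const).indicator hs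
  have hMi : Integrable (fun w => ∑ j ∈ Finset.range (N + 1), η j w • v j) P :=
    (memLp_sum_smul hL v (N + 1)).integrable one_le_two
  have hci : Integrable c P := (hMi.inner_const (v (N + 1))).indicator hs'
  have hind : IndepFun c (η (N + 1)) P := by
    refine indep_of_indep_of_le_left
      (hi.indep_comap_natural_of_lt hm (Nat.lt_succ_self N)).symm ?_
    exact hcm.measurable.comap_le
  have hprod : Integrable (fun w => η (N + 1) w * c w) P := by
    have := hind.integrable_mul hci ((hL (N + 1)).integrable one_le_two)
    exact this.congr (.of_forall fun w => mul_comm _ _)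
  have hzero : ∫ w, η (N + 1) w * c w ∂P = 0 := by
    have := hind.integral_fun_mul_eq_mul_integral hci.1 (hL (N + 1)).1
    rw [h0, mul_zero] at this
    rw [← this]
    exact integral_congr_ae (.of_forall fun w => mul_comm _ _)
  have hcross : ∫ w in s, 2 * (η (N + 1) w *
      inner ℂ (∑ j ∈ Finset.range (N + 1), η j w • v j) (v (N + 1))).re ∂P = 0 := by
    rw [integral_const_mul, ← integral_indicator hs']
    have h1 : ∫ w, (η (N + 1) w * c w).re ∂P = 0 := by
      have := integral_re hprod
      simp only [hzero] at this
      simpa using this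
    rw [mul_eq_zero]
    right
    rw [← h1]
    refine integral_congr_ae (.of_forall fun w => ?_)
    by_cases hw : w ∈ s <;> simp [c, hw]
  have hint1 := (memLp_sum_smul hL v (N + 1)).integrable_norm_pow two_ne_zero
  have hint2 : Integrable (fun w => ‖η (N + 1) w • v (N + 1)‖ ^ 2) P :=
    ((ContinuousLinearMap.toSpanSingleton ℂ (v (N + 1))).comp_memLp'
      (hL (N + 1))).integrable_norm_pow two_ne_zero
  have hint3 : Integrable (fun w => 2 * (η (N + 1) w *
      inner ℂ (∑ j ∈ Finset.range (N + 1), η j w • v j) (v (N + 1))).re) (P.restrict s) := by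
    refine Integrable.const_mul ?_ 2
    have h1 := ((integrable_indicator_iff hs').1 (hprod.re.congr (.of_forall fun w => ?_)) :
      IntegrableOn (fun w => (η (N + 1) w *
      inner ℂ (∑ j ∈ Finset.range (N + 1), η j w • v j) (v (N + 1))).re) s P)
    · exact h1
    · by_cases hw : w ∈ s <;> simp [c, hw]
  have e : ∀ w, ‖∑ j ∈ Finset.range (N + 2), η j w • v j‖ ^ 2 =
      ‖∑ j ∈ Finset.range (N + 1), η j w • v j‖ ^ 2 + 2 * (η (N + 1) w *
        inner ℂ (∑ j ∈ Finset.range (N + 1), η j w • v j) (v (N + 1))).re +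
      ‖η (N + 1) w • v (N + 1)‖ ^ 2 := fun w => by
    rw [Finset.sum_range_succ _ (N + 1), @norm_add_sq ℂ, inner_smul_right]
    rfl
  simp only [e]
  refine (integral_add (hint1.restrict.add hint3) hint2.restrict).trans ?_
  congr 1
  refine (integral_add hint1.restrict hint3).trans ?_
  rw [hcross, add_zero]

/-- The squared norm of a sum of independent centered random vectors is a submartingale. -/
lemma submartingale_sq_norm_sum [IsProbabilityMeasure P] (hm : ∀ j, StronglyMeasurable (η j))
    (hL : ∀ j, MemLp (η j) 2 P) (h0 : ∀ j, ∫ w, η j w ∂P = 0) (hi : iIndepFun η P) (v : ℕ → E) :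
    Submartingale (fun N w => ‖∑ j ∈ Finset.range (N + 1), η j w • v j‖ ^ 2)
      (Filtration.natural η hm) P := by
  refine submartingale_of_setIntegral_le_succ (fun N => ?_) (fun N => ?_) (fun N s hs => ?_)
  · exact (stronglyMeasurable_sum_smul_natural hm v N).norm.pow 2
  · exact (memLp_sum_smul hL v (N + 1)).integrable_norm_pow two_ne_zero
  · rw [setIntegral_sq_norm_sum_succ hm hL h0 hi v N hs]
    exact le_add_of_nonneg_right (integral_nonneg fun _ => sq_nonneg _)

/-- Pythagoras for the orthogonal increments: `setIntegral_sq_norm_sum_succ` on the whole space, by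
induction. -/
lemma integral_sq_norm_sum_eq [IsProbabilityMeasure P] (hm : ∀ j, StronglyMeasurable (η j))
    (hL : ∀ j, MemLp (η j) 2 P) (h0 : ∀ j, ∫ w, η j w ∂P = 0) (hi : iIndepFun η P) {σ : ℝ}
    (hσ : ∀ j, ∫ w, ‖η j w‖ ^ 2 ∂P = σ) (v : ℕ → E) (N : ℕ) :
    ∫ w, ‖∑ j ∈ Finset.range (N + 1), η j w • v j‖ ^ 2 ∂P =
      σ * ∑ j ∈ Finset.range (N + 1), ‖v j‖ ^ 2 := by
  have h1 : ∀ j, ∫ w, ‖η j w • v j‖ ^ 2 ∂P = σ * ‖v j‖ ^ 2 := fun j => by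
    simp only [norm_smul, mul_pow]
    rw [integral_mul_const, hσ]
  induction N with
  | zero => simpa using h1 0
  | succ N ih =>
    have := setIntegral_sq_norm_sum_succ hm hL h0 hi v N MeasurableSet.univ
    simp only [Measure.restrict_univ] at this
    rw [this, ih, h1, Finset.sum_range_succ _ (N + 1), mul_add]

/-- Kolmogorov's maximal inequality for random vectors. -/
lemma mul_measure_exists_le_sq_norm_sum [IsProbabilityMeasure P]
    (hm : ∀ j, StronglyMeasurable (η j))
    (hL : ∀ j, MemLp (η j) 2 P) (h0 : ∀ j, ∫ w, η j w ∂P = 0) (hi : iIndepFun η P) {σ : ℝ}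
    (hσ : ∀ j, ∫ w, ‖η j w‖ ^ 2 ∂P = σ) {v : ℕ → E} (hv : Summable fun j => ‖v j‖ ^ 2)
    (ε : NNReal) :
    ε * P {w | ∃ N, (ε : ℝ) ≤ ‖∑ j ∈ Finset.range (N + 1), η j w • v j‖ ^ 2} ≤
      ENNReal.ofReal (σ * ∑' j, ‖v j‖ ^ 2) := by
  have hσ0 : 0 ≤ σ := by
    rw [← hσ 0]
    exact integral_nonneg fun _ => sq_nonneg _
  have hmono : Monotone fun N => {w | ∃ k ≤ N, (ε : ℝ) ≤
      ‖∑ j ∈ Finset.range (k + 1), η j w • v j‖ ^ 2} := fun N N' h w ⟨k, hk, hw⟩ =>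
    ⟨k, hk.trans h, hw⟩
  have hU : {w | ∃ N, (ε : ℝ) ≤ ‖∑ j ∈ Finset.range (N + 1), η j w • v j‖ ^ 2} =
      ⋃ N, {w | ∃ k ≤ N, (ε : ℝ) ≤ ‖∑ j ∈ Finset.range (k + 1), η j w • v j‖ ^ 2} := by
    ext w
    simp only [mem_ofPred_eq, mem_iUnion]
    exact ⟨fun ⟨N, h⟩ => ⟨N, N, le_rfl, h⟩, fun ⟨_, k, _, h⟩ => ⟨k, h⟩⟩
  -- Doob's maximal inequality covers each finite horizon; continuity of the measure along
  -- increasing unions passes to all times.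
  rw [hU, hmono.measure_iUnion, ENNReal.mul_iSup]
  refine iSup_le fun N => ?_
  have h1 := maximal_ineq (submartingale_sq_norm_sum hm hL h0 hi v)
    (fun _ _ => sq_nonneg _) (ε := ε) N
  have h2 : {w | ∃ k ≤ N, (ε : ℝ) ≤ ‖∑ j ∈ Finset.range (k + 1), η j w • v j‖ ^ 2} =
      {w | (ε : ℝ) ≤ (Finset.range (N + 1)).sup' Finset.nonempty_range_add_one
        fun k => ‖∑ j ∈ Finset.range (k + 1), η j w • v j‖ ^ 2} := by
    ext w
    simp [Finset.le_sup'_iff]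
  rw [h2]
  refine h1.trans (ENNReal.ofReal_le_ofReal ?_)
  calc _ ≤ ∫ w, ‖∑ j ∈ Finset.range (N + 1), η j w • v j‖ ^ 2 ∂P :=
        setIntegral_le_integral ((memLp_sum_smul hL v (N + 1)).integrable_norm_pow two_ne_zero)
          (.of_forall fun _ => sq_nonneg _)
    _ = σ * ∑ j ∈ Finset.range (N + 1), ‖v j‖ ^ 2 := integral_sq_norm_sum_eq hm hL h0 hi hσ v N
    _ ≤ _ := by
        gcongr
        exact hv.sum_le_tsum _ fun _ _ => sq_nonneg _

/-- Almost sure convergence of a series of independent centered random vectors with summable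
variances. -/
theorem ae_cauchySeq_sum_smul [IsProbabilityMeasure P] (hm : ∀ j, StronglyMeasurable (η j))
    (hL : ∀ j, MemLp (η j) 2 P) (h0 : ∀ j, ∫ w, η j w ∂P = 0) (hi : iIndepFun η P) {σ : ℝ}
    (hσ : ∀ j, ∫ w, ‖η j w‖ ^ 2 ∂P = σ) {v : ℕ → E} (hv : Summable fun j => ‖v j‖ ^ 2) :
    ∀ᵐ w ∂P, CauchySeq fun N => ∑ j ∈ Finset.range N, η j w • v j := by
  have key : ∀ p : ℕ, ∀ᵐ w ∂P, ∃ m, ∀ N,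
      ‖∑ j ∈ Finset.range (N + 1), η (m + j) w • v (m + j)‖ ^ 2 < 1 / ((p : ℝ) + 1) := by
    intro p
    let ε : NNReal := 1 / ((p : NNReal) + 1)
    have hε : (ε : ℝ) = 1 / ((p : ℝ) + 1) := by simp [ε]
    have hε0 : (ε : ℝ≥0∞) ≠ 0 := by simp [ε]
    -- The bad event does not depend on the outer m, while the right-hand side is a tail of a
    -- convergent series. Letting m tend to infinity shows that the event is null.
    have hb : ∀ m, ε * P {w | ¬ ∃ m, ∀ N, ‖∑ j ∈ Finset.range (N + 1), η (m + j) w • v (m + j)‖ ^ 2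
        < 1 / ((p : ℝ) + 1)} ≤ ENNReal.ofReal (σ * ∑' j, ‖v (m + j)‖ ^ 2) := fun m => by
      refine le_trans ?_ (mul_measure_exists_le_sq_norm_sum (η := fun j => η (m + j))
        (fun j => hm _) (fun j => hL _) (fun j => h0 _) (hi.precomp (add_right_injective m))
        (fun j => hσ _) (v := fun j => v (m + j)) ?_ ε)
      · refine mul_le_mul_right (measure_mono fun w hw => ?_) _
        simp only [mem_ofPred_eq, not_exists, not_forall, not_lt] at hw ⊢
        rw [hε]
        exact hw m
      · exact hv.comp_injective (add_right_injective m)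
    have hlim : Tendsto (fun m => ENNReal.ofReal (σ * ∑' j, ‖v (m + j)‖ ^ 2)) atTop (𝓝 0) := by
      have h1 := tendsto_sum_nat_add fun j => ‖v j‖ ^ 2
      have h2 := ENNReal.tendsto_ofReal (h1.const_mul σ)
      simpa [add_comm] using h2
    have h3 := ge_of_tendsto' hlim hb
    rw [nonpos_iff_eq_zero, mul_eq_zero, or_iff_right hε0] at h3
    exact h3
  filter_upwards [ae_all_iff.2 key] with w hw
  rw [Metric.cauchySeq_iff']
  intro ε hε
  obtain ⟨p, hp⟩ := exists_nat_one_div_lt (show 0 < ε ^ 2 by positivity)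
  obtain ⟨m, hmN⟩ := hw p
  refine ⟨m, fun N hN => ?_⟩
  obtain ⟨k, rfl⟩ := Nat.exists_eq_add_of_le hN
  rw [dist_eq_norm, Finset.sum_range_add, add_sub_cancel_left]
  -- `key` controls only blocks of at least one term, so the empty block is treated separately.
  rcases k with _ | k
  · simpa using hε
  · exact lt_of_pow_lt_pow_left₀ 2 hε.le ((hmN k).trans hp)

end RandomSeries

/-! ### Characteristic functions of standard complex Gaussians -/

section CharFun

/-- The characteristic function of a standard complex Gaussian variable. -/
lemma integral_exp_stdComplexGaussian (a : ℂ) :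
    ∫ z, Complex.exp ((z * a).re * Complex.I) ∂stdComplexGaussian =
      Complex.exp (-(‖a‖ ^ 2 / 4 : ℝ)) := by
  have h2 : Real.sqrt 2 ≠ 0 := by positivity
  have hc : Measurable fun p : ℝ × ℝ =>
      ((p.1 : ℂ) + Complex.I * (p.2 : ℂ)) / (Real.sqrt 2 : ℂ) := by fun_prop
  rw [stdComplexGaussian, integral_map hc.aemeasurable
    (Continuous.aestronglyMeasurable (by fun_prop))]
  have e : ∀ p : ℝ × ℝ, Complex.exp (((((p.1 : ℂ) + Complex.I * (p.2 : ℂ)) /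
      (Real.sqrt 2 : ℂ) * a).re : ℝ) * Complex.I) =
      Complex.exp ((a.re / Real.sqrt 2 : ℝ) * p.1 * Complex.I) *
      Complex.exp ((-a.im / Real.sqrt 2 : ℝ) * p.2 * Complex.I) := fun p => by
    rw [← Complex.exp_add]
    congr 1
    -- Re(za) is a combination of two independent standard Gaussians with coefficients Re a/√2 and
    -- -Im a/√2. Its variance is |a|²/2, hence the exponent -|a|²/4.
    have : (((p.1 : ℂ) + Complex.I * (p.2 : ℂ)) / (Real.sqrt 2 : ℂ) * a).re =
        a.re / Real.sqrt 2 * p.1 + -a.im / Real.sqrt 2 * p.2 := by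
      rw [Complex.mul_re, Complex.div_ofReal_re, Complex.div_ofReal_im]
      simp
      ring
    rw [this]
    push_cast
    ring
  simp only [e]
  rw [integral_prod_mul (fun x : ℝ => Complex.exp ((a.re / Real.sqrt 2 : ℝ) * x * Complex.I))
    (fun x : ℝ => Complex.exp ((-a.im / Real.sqrt 2 : ℝ) * x * Complex.I)),
    ← charFun_apply_real, ← charFun_apply_real, charFun_gaussianReal, charFun_gaussianReal,
    ← Complex.exp_add]
  congr 1
  have hs : ((Real.sqrt 2 : ℝ) : ℂ) ^ 2 = 2 := by
    rw [← Complex.ofReal_pow, Real.sq_sqrt zero_le_two]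
    simp
  have hn : ‖a‖ ^ 2 = a.re ^ 2 + a.im ^ 2 := by
    rw [Complex.sq_norm, Complex.normSq_apply]
    ring
  rw [hn]
  push_cast
  rw [div_pow, div_pow, hs]
  ring

/-- The exponential of the sum is a product of functions of the independent η_j, so the expectation
factors. -/
lemma integral_exp_sum_mul {Ω ι : Type*} [MeasurableSpace Ω] {P : Measure Ω} {η : ι → Ω → ℂ}
    (hη : IsIIDStdComplexGaussian η P) (a : ι → ℂ) (F : Finset ι) :
    ∫ w, Complex.exp ((∑ j ∈ F, η j w * a j).re * Complex.I) ∂P =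
      Complex.exp (-((∑ j ∈ F, ‖a j‖ ^ 2) / 4 : ℝ)) := by
  have hmeas : ∀ j : F, AEMeasurable (η j) P := fun j => (hη.law j).aemeasurable
  have hi : iIndepFun (fun j : F => η j) P := hη.indep.precomp Subtype.val_injective
  let g : F → ℂ → ℂ := fun j z => Complex.exp ((z * a j).re * Complex.I)
  have hg : ∀ j, Continuous (g j) := fun j => by fun_prop
  have h1 := (hi.comp g fun j => (hg j).measurable).integral_fun_prod_eq_prod_integral
    fun j => (hg j).comp_aestronglyMeasurable (hmeas j).aestronglyMeasurable
  have h2 : ∀ j : F, ∫ w, (g j ∘ η j) w ∂P = Complex.exp (-(‖a j‖ ^ 2 / 4 : ℝ)) := fun j => by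
    rw [← integral_exp_stdComplexGaussian, ← (hη.law j).map_eq,
      integral_map (hmeas j) (hg j).aestronglyMeasurable]
    rfl
  simp only [h2] at h1
  rw [← Complex.exp_sum] at h1
  calc _ = ∫ w, ∏ j : F, (g j ∘ η j) w ∂P := by
        refine integral_congr_ae (.of_forall fun w => ?_)
        simp only [g, Function.comp_apply]
        rw [← Complex.exp_sum, ← Finset.sum_mul, ← Complex.ofReal_sum, ← Complex.re_sum,
          Finset.sum_coe_sort F fun j => η j w * a j]
    _ = _ := h1
    _ = _ := by
        congr 1
        rw [Finset.sum_coe_sort F fun j => (-((‖a j‖ ^ 2 / 4 : ℝ) : ℂ)), Finset.sum_neg_distrib,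
          ← Complex.ofReal_sum, Finset.sum_div]

end CharFun

/-! ### Bessel and Parseval for bounded functionals, without completeness -/

section Parseval

variable {E ι ι' : Type*} [SeminormedAddCommGroup E] [InnerProductSpace ℂ E] {S : ι → E}

lemma sq_norm_sum_smul_of_orthonormal (hS : Orthonormal ℂ S) (c : ι → ℂ) (F : Finset ι) :
    ‖∑ j ∈ F, c j • S j‖ ^ 2 = ∑ j ∈ F, ‖c j‖ ^ 2 := by
  rw [@norm_sq_eq_re_inner ℂ, hS.inner_sum c c F, map_sum]
  refine Finset.sum_congr rfl fun j _ => ?_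
  rw [RCLike.conj_mul, ← RCLike.ofReal_pow, RCLike.ofReal_re]

/-- Bessel's inequality for a bounded functional. -/
lemma sum_sq_norm_apply_le (hS : Orthonormal ℂ S) {l : E →ₗ[ℂ] ℂ} {M : ℝ}
    (hM : ∀ s, ‖l s‖ ≤ M * ‖s‖) (F : Finset ι) : ∑ j ∈ F, ‖l (S j)‖ ^ 2 ≤ M ^ 2 := by
  set A := ∑ j ∈ F, ‖l (S j)‖ ^ 2 with hA
  have hA0 : 0 ≤ A := Finset.sum_nonneg fun _ _ => sq_nonneg _
  -- The test vector ∑ conj(l(S_j)) S_j has squared norm A, and l takes the value A on it. The bound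
  -- on l gives A² ≤ M²A.
  have h1 : ‖∑ j ∈ F, conj (l (S j)) • S j‖ ^ 2 = A := by
    rw [sq_norm_sum_smul_of_orthonormal hS (fun j => conj (l (S j)))]
    simp [hA]
  have h2 : l (∑ j ∈ F, conj (l (S j)) • S j) = (A : ℂ) := by
    rw [map_sum, hA, Complex.ofReal_sum]
    refine Finset.sum_congr rfl fun j _ => ?_
    rw [map_smul, smul_eq_mul, Complex.conj_mul', Complex.ofReal_pow]
  have h3 := hM (∑ j ∈ F, conj (l (S j)) • S j)
  rw [h2, Complex.norm_real, Real.norm_of_nonneg hA0] at h3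
  have h4 : A ^ 2 ≤ M ^ 2 * A := by
    rw [← h1, ← mul_pow, h1]
    exact pow_le_pow_left₀ hA0 h3 2
  rcases hA0.eq_or_lt with h0 | h0
  · rw [← h0]
    exact sq_nonneg M
  · rw [sq] at h4
    exact le_of_mul_le_mul_right h4 h0

/-- Cauchy–Schwarz gives the bound on finite combinations of the S_j. It is a closed condition, so
it extends from the dense span to the whole space. -/
lemma norm_apply_le_of_dense_span (hS : Orthonormal ℂ S)
    (hd : Dense (Submodule.span ℂ (range S) : Set E)) {l : E →ₗ[ℂ] ℂ} (hl : Continuous l) {B : ℝ}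
    (hB0 : 0 ≤ B) (hB : ∀ F : Finset ι, ∑ j ∈ F, ‖l (S j)‖ ^ 2 ≤ B ^ 2) (s : E) :
    ‖l s‖ ≤ B * ‖s‖ := by
  have hcl : IsClosed {s : E | ‖l s‖ ≤ B * ‖s‖} :=
    isClosed_le hl.norm (continuous_const.mul continuous_norm)
  refine hcl.closure_subset_iff.2 ?_ (hd s)
  intro s hs
  obtain ⟨c, rfl⟩ := Finsupp.mem_span_range_iff_exists_finsupp.1 hs
  simp only [Finsupp.sum, mem_ofPred_eq, map_sum, map_smul, smul_eq_mul]
  have h1 := sq_norm_sum_smul_of_orthonormal hS c c.support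
  refine le_of_sq_le_sq ?_ (by positivity)
  rw [mul_pow, h1]
  calc ‖∑ j ∈ c.support, c j * l (S j)‖ ^ 2
      ≤ (∑ j ∈ c.support, ‖c j‖ * ‖l (S j)‖) ^ 2 := by
        gcongr
        exact (norm_sum_le _ _).trans_eq (by simp)
    _ ≤ (∑ j ∈ c.support, ‖c j‖ ^ 2) * ∑ j ∈ c.support, ‖l (S j)‖ ^ 2 :=
        Finset.sum_mul_sq_le_sq_mul_sq _ _ _
    _ ≤ (∑ j ∈ c.support, ‖c j‖ ^ 2) * B ^ 2 := by
        gcongr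
        exact hB _
    _ = _ := mul_comm _ _

lemma summable_sq_norm_apply (hS : Orthonormal ℂ S) {l : E →ₗ[ℂ] ℂ} {M : ℝ}
    (hM : ∀ s, ‖l s‖ ≤ M * ‖s‖) : Summable fun j => ‖l (S j)‖ ^ 2 :=
  summable_of_sum_le (fun _ => sq_nonneg _) (sum_sq_norm_apply_le hS hM)

/-- Density of the span of S makes the root of its sum a bound for the norm of l; Bessel's
inequality for S' with that bound is the claim. Symmetry then yields Parseval. -/
lemma tsum_sq_norm_apply_le {S' : ι' → E} (hS : Orthonormal ℂ S)
    (hd : Dense (Submodule.span ℂ (range S) : Set E)) (hS' : Orthonormal ℂ S') {l : E →ₗ[ℂ] ℂ}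
    {M : ℝ} (hM : ∀ s, ‖l s‖ ≤ M * ‖s‖) : ∑' j, ‖l (S' j)‖ ^ 2 ≤ ∑' j, ‖l (S j)‖ ^ 2 := by
  have h0 : 0 ≤ ∑' j, ‖l (S j)‖ ^ 2 := tsum_nonneg fun _ => sq_nonneg _
  have h1 := norm_apply_le_of_dense_span hS hd
    (AddMonoidHomClass.continuous_of_bound l M hM) (Real.sqrt_nonneg (∑' j, ‖l (S j)‖ ^ 2))
    fun F => by
      rw [Real.sq_sqrt h0]
      exact (summable_sq_norm_apply hS hM).sum_le_tsum F fun _ _ => sq_nonneg _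
  refine Real.tsum_le_of_sum_le (fun _ => sq_nonneg _) fun F => ?_
  have := sum_sq_norm_apply_le hS' h1 F
  rwa [Real.sq_sqrt h0] at this

/-- Parseval's identity: the sum `∑ ‖l (S j)‖²` does not depend on the orthonormal basis. -/
theorem tsum_sq_norm_apply_eq {S' : ι' → E} (hS : Orthonormal ℂ S)
    (hd : Dense (Submodule.span ℂ (range S) : Set E)) (hS' : Orthonormal ℂ S')
    (hd' : Dense (Submodule.span ℂ (range S') : Set E)) {l : E →ₗ[ℂ] ℂ}
    {M : ℝ} (hM : ∀ s, ‖l s‖ ≤ M * ‖s‖) : ∑' j, ‖l (S j)‖ ^ 2 = ∑' j, ‖l (S' j)‖ ^ 2 :=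
  le_antisymm (tsum_sq_norm_apply_le hS' hd' hS hM) (tsum_sq_norm_apply_le hS hd hS' hM)

end Parseval

/-! ### Positivity of the volume density -/

section Density

variable {n : ℕ} {X : Type*} [TopologicalSpace X] [ChartedSpace (EuclideanSpace ℂ (Fin n)) X]
  [IsManifold 𝓘(ℂ, EuclideanSpace ℂ (Fin n)) ω X]

/-- The differential of the chart is a left inverse. -/
lemma chartVec_injective {φ : OpenPartialHomeomorph X (EuclideanSpace ℂ (Fin n))}
    (hφ : φ ∈ atlas (EuclideanSpace ℂ (Fin n)) X) {z : EuclideanSpace ℂ (Fin n)}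
    (hz : z ∈ φ.target) : Function.Injective (chartVec φ z) := by
  have : IsManifold 𝓘(ℂ, EuclideanSpace ℂ (Fin n)) 1 X := .of_le (n := ω) le_top
  have hd : φ.MDifferentiable 𝓘(ℂ, EuclideanSpace ℂ (Fin n)) 𝓘(ℂ, EuclideanSpace ℂ (Fin n)) :=
    mdifferentiable_of_mem_atlas hφ
  have h1 := hd.comp_symm_deriv hz
  intro u v huv
  have h2 := DFunLike.congr_fun h1 u
  have h3 := DFunLike.congr_fun h1 v
  have h4 : mfderiv 𝓘(ℂ, EuclideanSpace ℂ (Fin n)) 𝓘(ℂ, EuclideanSpace ℂ (Fin n)) φ (φ.symm z)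
      (chartVec φ z u) = mfderiv 𝓘(ℂ, EuclideanSpace ℂ (Fin n)) 𝓘(ℂ, EuclideanSpace ℂ (Fin n))
        φ (φ.symm z) (chartVec φ z v) := congrArg _ huv
  exact (h2.symm.trans h4).trans h3

/-- The matrix under the root is the Gram matrix of the Riemannian metric in a real basis of the
tangent space, hence positive definite. -/
lemma HermitianForm.volDensity_pos (Θ : HermitianForm n X)
    {φ : OpenPartialHomeomorph X (EuclideanSpace ℂ (Fin n))}
    (hφ : φ ∈ atlas (EuclideanSpace ℂ (Fin n)) X) {z : EuclideanSpace ℂ (Fin n)}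
    (hz : z ∈ φ.target) : 0 < Θ.volDensity φ z := by
  obtain ⟨b, hb⟩ := HermitianForm.exists_basis n
  have hinj := chartVec_injective hφ hz
  have hsm : ∀ (c : ℝ) (u : EuclideanSpace ℂ (Fin n)), chartVec φ z (c • u) =
      c • chartVec φ z u := fun c u => (chartVec φ z).map_smul (c : ℂ) u
  have hsm' : ∀ (c : ℝ) (u : TangentSpace 𝓘(ℂ, EuclideanSpace ℂ (Fin n)) (φ.symm z)),
      Complex.I • c • u = c • Complex.I • u := fun c u => smul_comm _ _ _
  let B : LinearMap.BilinForm ℝ (EuclideanSpace ℂ (Fin n)) :=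
    LinearMap.mk₂ ℝ (fun u v => Θ.metric (φ.symm z) (chartVec φ z u) (chartVec φ z v))
      (fun u u' v => by simp [metric]) (fun c u v => by simp [metric, hsm])
      (fun u v v' => by simp [metric]) (fun c u v => by simp [metric, hsm, hsm'])
  have hsymm : ∀ u v, B u v = B v u := by
    intro u v
    change Θ.form _ (chartVec φ z u) (Complex.I • chartVec φ z v) =
      Θ.form _ (chartVec φ z v) (Complex.I • chartVec φ z u)
    have hswap : ∀ a b, Θ.form (φ.symm z) a b = - Θ.form (φ.symm z) b a := fun a b => by
      have h1 := Θ.alternating (φ.symm z) (a + b)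
      simp only [map_add, LinearMap.add_apply, Θ.alternating] at h1
      linarith
    -- Symmetry of g: Θ(u, Jv) = Θ(Ju, JJv) = -Θ(Ju, v) = Θ(v, Ju).
    rw [← Θ.invariant, hswap, smul_smul, Complex.I_mul_I, neg_smul, one_smul, map_neg,
      LinearMap.neg_apply, neg_neg]
  rw [HermitianForm.volDensity]
  refine Real.sqrt_pos.2 (Matrix.PosDef.det_pos ?_)
  refine Matrix.PosDef.of_dotProduct_mulVec_pos ?_ ?_
  · ext i j
    exact hsymm (coordFrame n j) (coordFrame n i)
  · intro x hx
    have e : star x ⬝ᵥ (Matrix.of fun a b : Fin n ⊕ Fin n => Θ.metric (φ.symm z)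
        (chartVec φ z (coordFrame n a)) (chartVec φ z (coordFrame n b))).mulVec x =
        B (∑ a, x a • b a) (∑ a, x a • b a) := by
      simp only [map_sum, LinearMap.sum_apply, map_smul, LinearMap.smul_apply, smul_eq_mul,
        dotProduct, Matrix.mulVec, hb, Finset.mul_sum, Matrix.of_apply, star_trivial]
      rw [Finset.sum_comm]
      refine Finset.sum_congr rfl fun i _ => Finset.sum_congr rfl fun j _ => ?_
      change x j * (B (coordFrame n j) (coordFrame n i) * x i) = _
      ring
    rw [e]
    refine Θ.positive _ _ fun h0 => hx ?_
    have h1 : ∑ a, x a • b a = 0 := hinj (h0.trans (map_zero _).symm)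
    exact funext (Fintype.linearIndependent_iff.1 b.linearIndependent x h1)

end Density

/-! ### Coordinate expressions of sections, local frames and concentric balls -/

section Coordinates

variable {n : ℕ} {X : Type*} [TopologicalSpace X] [ChartedSpace (EuclideanSpace ℂ (Fin n)) X]
  {L : X → Type*} [TopologicalSpace (TotalSpace ℂ L)]
  [∀ x, AddCommGroup (L x)] [∀ x, Module ℂ (L x)] [∀ x, TopologicalSpace (L x)]
  [FiberBundle ℂ L] [VectorBundle ℂ ℂ L]

variable (n L) in
/-- The part of the target of the chart at `x₀` over which `L` is trivialized. -/
def coordDomain (x₀ : X) : Set (EuclideanSpace ℂ (Fin n)) :=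
  (chartAt (EuclideanSpace ℂ (Fin n)) x₀).target ∩
    (chartAt (EuclideanSpace ℂ (Fin n)) x₀).symm ⁻¹' (trivializationAt ℂ L x₀).baseSet

variable (n) in
/-- The coordinate expression of a section of `L` near `x₀`. -/
def coord (x₀ : X) (s : ∀ x, L x) (z : EuclideanSpace ℂ (Fin n)) : ℂ :=
  (trivializationAt ℂ L x₀ ⟨(chartAt (EuclideanSpace ℂ (Fin n)) x₀).symm z,
    s ((chartAt (EuclideanSpace ℂ (Fin n)) x₀).symm z)⟩).2

/-- The length of the local frame of `L` near `x₀`. -/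
def frameNorm (h : HermitianMetric n L) (x₀ : X) (z : EuclideanSpace ℂ (Fin n)) : ℝ :=
  h.norm ((chartAt (EuclideanSpace ℂ (Fin n)) x₀).symm z)
    ((trivializationAt ℂ L x₀).symm ((chartAt (EuclideanSpace ℂ (Fin n)) x₀).symm z) 1)

lemma isOpen_coordDomain (x₀ : X) : IsOpen (coordDomain n L x₀) :=
  (chartAt (EuclideanSpace ℂ (Fin n)) x₀).isOpen_inter_preimage_symm
    (trivializationAt ℂ L x₀).open_baseSet

lemma chartAt_mem_coordDomain (x₀ : X) :
    chartAt (EuclideanSpace ℂ (Fin n)) x₀ x₀ ∈ coordDomain n L x₀ := by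
  refine ⟨mem_chart_target _ x₀, ?_⟩
  rw [mem_preimage, OpenPartialHomeomorph.left_inv _ (mem_chart_source _ x₀)]
  exact mem_baseSet_trivializationAt ℂ L x₀

/-- The doubled ball leaves room for two applications of the mean value inequality. With the radius
as unit, the L² norm on the ball of size 2 controls values on the ball of size 1, and the L² norm on
size 1 controls values on size 1/2. The half balls define the cover and the topology. -/
lemma exists_chartRadius (x₀ : X) : ∃ r : ℝ, 0 < r ∧
    Metric.closedBall (chartAt (EuclideanSpace ℂ (Fin n)) x₀ x₀) (2 * r) ⊆ coordDomain n L x₀ := by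
  obtain ⟨r, hr, h⟩ := Metric.nhds_basis_closedBall.mem_iff.1
    ((isOpen_coordDomain (n := n) (L := L) x₀).mem_nhds (chartAt_mem_coordDomain x₀))
  exact ⟨r / 2, by positivity, by rwa [mul_div_cancel₀ _ two_ne_zero]⟩

variable (n L) in
/-- The radius of a ball around `x₀` in the chart at `x₀` whose double lies in the domain of the
coordinate expressions. -/
def chartRadius (x₀ : X) : ℝ := (exists_chartRadius (n := n) (L := L) x₀).choose

lemma chartRadius_pos (x₀ : X) : 0 < chartRadius n L x₀ :=
  (exists_chartRadius (n := n) (L := L) x₀).choose_spec.1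

variable (n L) in
/-- The closed ball of radius `t * chartRadius` around `x₀` in the chart at `x₀`. -/
def chartBall (x₀ : X) (t : ℝ) : Set (EuclideanSpace ℂ (Fin n)) :=
  Metric.closedBall (chartAt (EuclideanSpace ℂ (Fin n)) x₀ x₀) (t * chartRadius n L x₀)

lemma isCompact_chartBall (x₀ : X) (t : ℝ) : IsCompact (chartBall n L x₀ t) :=
  isCompact_closedBall _ _

instance (x₀ : X) (t : ℝ) : CompactSpace (chartBall n L x₀ t) :=
  isCompact_iff_compactSpace.1 (isCompact_chartBall x₀ t)

lemma chartBall_subset {x₀ : X} {t : ℝ} (ht : t ≤ 2) : chartBall n L x₀ t ⊆ coordDomain n L x₀ :=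
  (Metric.closedBall_subset_closedBall
    (mul_le_mul_of_nonneg_right ht (chartRadius_pos x₀).le)).trans
    (exists_chartRadius (n := n) (L := L) x₀).choose_spec.2

lemma closedBall_subset_chartBall {x₀ : X} {t u : ℝ} {z : EuclideanSpace ℂ (Fin n)}
    (hz : z ∈ chartBall n L x₀ t) :
    Metric.closedBall z (u * chartRadius n L x₀) ⊆ chartBall n L x₀ (t + u) := by
  refine Metric.closedBall_subset_closedBall' ?_
  have : dist z _ ≤ t * chartRadius n L x₀ := hz
  linarith

variable (n L) in
/-- A neighbourhood of `x₀` on which coordinates are available. -/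
def chartNhd (x₀ : X) : Set X :=
  (chartAt (EuclideanSpace ℂ (Fin n)) x₀).source ∩ chartAt (EuclideanSpace ℂ (Fin n)) x₀ ⁻¹'
    Metric.ball (chartAt (EuclideanSpace ℂ (Fin n)) x₀ x₀) (1 / 2 * chartRadius n L x₀)

lemma isOpen_chartNhd (x₀ : X) : IsOpen (chartNhd n L x₀) :=
  (chartAt (EuclideanSpace ℂ (Fin n)) x₀).isOpen_inter_preimage Metric.isOpen_ball

lemma mem_chartNhd (x₀ : X) : x₀ ∈ chartNhd n L x₀ :=
  ⟨mem_chart_source _ x₀, Metric.mem_ball_self (mul_pos one_half_pos (chartRadius_pos x₀))⟩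

lemma ball_subset_chartBall (x₀ : X) :
    Metric.ball (chartAt (EuclideanSpace ℂ (Fin n)) x₀ x₀) (1 / 2 * chartRadius n L x₀) ⊆
      chartBall n L x₀ (1 / 2) :=
  Metric.ball_subset_closedBall

lemma isCompact_image_chartBall (x₀ : X) {t : ℝ} (ht : t ≤ 2) :
    IsCompact ((chartAt (EuclideanSpace ℂ (Fin n)) x₀).symm '' chartBall n L x₀ t) :=
  (isCompact_chartBall x₀ t).image_of_continuousOn
    ((chartAt (EuclideanSpace ℂ (Fin n)) x₀).continuousOn_symm.mono
      fun _ hz => (chartBall_subset ht hz).1)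

lemma coord_add {x₀ : X} {z : EuclideanSpace ℂ (Fin n)} (hz : z ∈ coordDomain n L x₀)
    (s t : ∀ x, L x) : coord n x₀ (s + t) z = coord n x₀ s z + coord n x₀ t z :=
  ((trivializationAt ℂ L x₀).linear ℂ hz.2).map_add _ _

lemma coord_smul {x₀ : X} {z : EuclideanSpace ℂ (Fin n)} (hz : z ∈ coordDomain n L x₀)
    (c : ℂ) (s : ∀ x, L x) : coord n x₀ (c • s) z = c * coord n x₀ s z :=
  ((trivializationAt ℂ L x₀).linear ℂ hz.2).map_smul _ _

lemma eq_coord_smul {x₀ : X} {z : EuclideanSpace ℂ (Fin n)} (hz : z ∈ coordDomain n L x₀)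
    (s : ∀ x, L x) : s ((chartAt (EuclideanSpace ℂ (Fin n)) x₀).symm z) =
      coord n x₀ s z • (trivializationAt ℂ L x₀).symm
        ((chartAt (EuclideanSpace ℂ (Fin n)) x₀).symm z) 1 := by
  have h1 := (trivializationAt ℂ L x₀).symm_apply_apply_mk hz.2
    (s ((chartAt (EuclideanSpace ℂ (Fin n)) x₀).symm z))
  have h3 := Trivialization.coe_symmₗ (R := ℂ) (trivializationAt ℂ L x₀) hz.2
  rw [← h3, ← map_smul, smul_eq_mul, mul_one, h3]
  exact h1.symm

lemma norm_eq_coord_mul (h : HermitianMetric n L) {x₀ : X} {z : EuclideanSpace ℂ (Fin n)}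
    (hz : z ∈ coordDomain n L x₀) (s : ∀ x, L x) :
    h.norm _ (s ((chartAt (EuclideanSpace ℂ (Fin n)) x₀).symm z)) =
      ‖coord n x₀ s z‖ * frameNorm h x₀ z := by
  rw [eq_coord_smul hz s, h.norm_smul, frameNorm]

/-- The trivialization maps the frame vector to 1 and the zero vector to 0, so the frame vanishes
nowhere. -/
lemma frameNorm_pos (h : HermitianMetric n L) {x₀ : X} {z : EuclideanSpace ℂ (Fin n)}
    (hz : z ∈ coordDomain n L x₀) : 0 < frameNorm h x₀ z := by
  refine Real.sqrt_pos.2 (h.positive _ _ fun h0 => ?_)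
  have h1 := (trivializationAt ℂ L x₀).apply_mk_symm hz.2 (1 : ℂ)
  rw [h0] at h1
  have h2 := (trivializationAt ℂ L x₀).zeroSection ℂ hz.2
  exact zero_ne_one (congrArg Prod.snd (h2.symm.trans h1))

lemma continuousOn_frameNorm (h : HermitianMetric n L) (x₀ : X) :
    ContinuousOn (frameNorm h x₀) (coordDomain n L x₀) := by
  have h1 := (h.smooth (trivializationAt ℂ L x₀)).continuousOn
  exact (h1.comp ((chartAt (EuclideanSpace ℂ (Fin n)) x₀).continuousOn_symm.mono
    inter_subset_left) fun _ hz => hz.2).sqrt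

/-- By compactness, |s|_h and the modulus of the coordinate expression are comparable on the largest
ball. -/
lemma exists_frameNorm_bounds (h : HermitianMetric n L) (x₀ : X) : ∃ a A : ℝ, 0 < a ∧ 0 < A ∧
    ∀ z ∈ chartBall n L x₀ 2, a ≤ frameNorm h x₀ z ∧ frameNorm h x₀ z ≤ A := by
  have hc := (continuousOn_frameNorm h x₀).mono (chartBall_subset (L := L) (x₀ := x₀) le_rfl)
  obtain ⟨A, hA⟩ := (isCompact_chartBall x₀ 2).bddAbove_image hc
  have hpos : ∀ z ∈ chartBall n L x₀ 2, 0 < frameNorm h x₀ z := fun z hz =>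
    frameNorm_pos h (chartBall_subset le_rfl hz)
  obtain ⟨a, ha, ha'⟩ := (isCompact_chartBall x₀ 2).exists_forall_le' hc hpos
  exact ⟨a, max A 1, ha, by positivity, fun z hz =>
    ⟨ha' z hz, (hA (mem_image_of_mem _ hz)).trans (le_max_left _ _)⟩⟩

section Holomorphic

variable [IsManifold 𝓘(ℂ, EuclideanSpace ℂ (Fin n)) ω X]
  [ContMDiffVectorBundle ω ℂ L 𝓘(ℂ, EuclideanSpace ℂ (Fin n))]

lemma differentiableOn_coord {h : HermitianMetric n L} (s : HolSection h) (x₀ : X) :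
    DifferentiableOn ℂ (coord n x₀ s) (coordDomain n L x₀) := by
  have : IsManifold 𝓘(ℂ, EuclideanSpace ℂ (Fin n)) 1 X := .of_le (n := ω) le_top
  have : ContMDiffVectorBundle 1 ℂ L 𝓘(ℂ, EuclideanSpace ℂ (Fin n)) := .of_le (n := ω) le_top
  intro z hz
  have h1 := ((trivializationAt ℂ L x₀).mdifferentiableAt_section_iff
    𝓘(ℂ, EuclideanSpace ℂ (Fin n)) s.toSection hz.2).1 (s.2 _)
  have h2 : MDifferentiableAt 𝓘(ℂ, EuclideanSpace ℂ (Fin n)) 𝓘(ℂ, EuclideanSpace ℂ (Fin n))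
      (chartAt (EuclideanSpace ℂ (Fin n)) x₀).symm z :=
    mdifferentiableAt_atlas_symm (chart_mem_atlas _ x₀) hz.1
  exact (h1.comp z h2).differentiableAt.differentiableWithinAt

lemma mdifferentiableAt_of_coord {s : ∀ x, L x} {x₀ : X} {z : EuclideanSpace ℂ (Fin n)}
    (hz : z ∈ coordDomain n L x₀) (hs : DifferentiableAt ℂ (coord n x₀ s) z) :
    MDifferentiableAt 𝓘(ℂ, EuclideanSpace ℂ (Fin n))
      (𝓘(ℂ, EuclideanSpace ℂ (Fin n)).prod 𝓘(ℂ, ℂ)) (fun x => TotalSpace.mk' ℂ x (s x))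
      ((chartAt (EuclideanSpace ℂ (Fin n)) x₀).symm z) := by
  have : IsManifold 𝓘(ℂ, EuclideanSpace ℂ (Fin n)) 1 X := .of_le (n := ω) le_top
  have : ContMDiffVectorBundle 1 ℂ L 𝓘(ℂ, EuclideanSpace ℂ (Fin n)) := .of_le (n := ω) le_top
  set φ := chartAt (EuclideanSpace ℂ (Fin n)) x₀ with hφ
  refine ((trivializationAt ℂ L x₀).mdifferentiableAt_section_iff
    𝓘(ℂ, EuclideanSpace ℂ (Fin n)) s hz.2).2 ?_
  have hx : φ.symm z ∈ φ.source := φ.map_target hz.1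
  have h1 : MDifferentiableAt 𝓘(ℂ, EuclideanSpace ℂ (Fin n)) 𝓘(ℂ, EuclideanSpace ℂ (Fin n))
      φ (φ.symm z) := mdifferentiableAt_atlas (chart_mem_atlas _ x₀) hx
  have h2 : MDifferentiableAt 𝓘(ℂ, EuclideanSpace ℂ (Fin n)) 𝓘(ℂ, ℂ) (coord n x₀ s)
      (φ (φ.symm z)) := by
    rw [φ.right_inv hz.1]
    exact hs.mdifferentiableAt
  refine (h2.comp _ h1).congr_of_eventuallyEq ?_
  filter_upwards [φ.open_source.mem_nhds hx] with x hx
  simp only [coord, Function.comp_apply]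
  rw [← hφ, φ.left_inv hx]

end Holomorphic

/-! ### Comparison of local and global L² norms -/

section Volume

variable [IsManifold 𝓘(ℂ, EuclideanSpace ℂ (Fin n)) ω X]
  [ContMDiffVectorBundle ω ℂ L 𝓘(ℂ, EuclideanSpace ℂ (Fin n))]
  [MeasurableSpace X] [BorelSpace X] [SecondCountableTopology X]

/-- The local `L²` norm of the coordinate expression is controlled by the global `L²` norm. -/
lemma exists_lintegral_coord_le (Θ : HermitianForm n X) (h : HermitianMetric n L) (x₀ : X) :
    ∃ M : ℝ≥0∞, M ≠ ⊤ ∧ ∀ s : HolSection h,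
      ∫⁻ z in chartBall n L x₀ 2, ‖coord n x₀ s z‖ₑ ^ 2 ≤
        M * ∫⁻ x, ENNReal.ofReal (h.norm x (s x) ^ 2) ∂Θ.vol := by
  set φ := chartAt (EuclideanSpace ℂ (Fin n)) x₀ with hφ
  have hφa : φ ∈ atlas (EuclideanSpace ℂ (Fin n)) X := chart_mem_atlas _ x₀
  have hsub : chartBall n L x₀ 2 ⊆ coordDomain n L x₀ := chartBall_subset le_rfl
  obtain ⟨a, A, ha, -, hb⟩ := exists_frameNorm_bounds h x₀
  obtain ⟨c, hc, hc'⟩ := (isCompact_chartBall (n := n) (L := L) x₀ 2).exists_forall_le'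
    ((Θ.continuousOn_volDensity hφa).mono fun z hz => (hsub hz).1)
    fun z hz => Θ.volDensity_pos hφa (hsub hz).1
  have hpos : 0 < a ^ 2 * c := by positivity
  -- On the ball, |s|²_h dV is at least a²c times the squared modulus of the coordinate expression
  -- times Lebesgue measure: a bounds the frame from below, c the density.
  refine ⟨(ENNReal.ofReal (a ^ 2 * c))⁻¹, by simpa using hpos, fun s => ?_⟩
  have hm : AEMeasurable φ.symm (volume.restrict φ.target) :=
    φ.continuousOn_symm.aemeasurable φ.open_target.measurableSet
  have hdm : AEMeasurable (fun z => ENNReal.ofReal (Θ.volDensity φ z))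
      (volume.restrict φ.target) :=
    ((Θ.continuousOn_volDensity hφa).aemeasurable φ.open_target.measurableSet).ennreal_ofReal
  have hsm : Measurable fun x => ENNReal.ofReal (h.norm x (s x) ^ 2) :=
    (s.continuous_norm.pow 2).measurable.ennreal_ofReal
  have h1 : ∫⁻ z in φ.target, ENNReal.ofReal (Θ.volDensity φ z) *
      ENNReal.ofReal (h.norm _ (s (φ.symm z)) ^ 2) ≤
      ∫⁻ x, ENNReal.ofReal (h.norm x (s x) ^ 2) ∂Θ.vol := by
    refine le_trans (le_of_eq ?_) (setLIntegral_le_lintegral φ.source _)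
    rw [Θ.vol_restrict_source hφa, HermitianForm.chartVol, lintegral_map' hsm.aemeasurable
      (hm.mono_ac (withDensity_absolutelyContinuous _ _))]
    exact (lintegral_withDensity_eq_lintegral_mul₀ hdm (hsm.comp_aemeasurable hm)).symm
  rw [← ENNReal.mul_le_iff_le_inv (by simpa using hpos) ENNReal.ofReal_ne_top]
  refine le_trans ?_ h1
  rw [← lintegral_const_mul' _ _ ENNReal.ofReal_ne_top]
  refine (setLIntegral_mono' (isCompact_chartBall x₀ 2).measurableSet fun z hz => ?_).trans
    (lintegral_mono_set fun z hz => (hsub hz).1)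
  rw [norm_eq_coord_mul h (hsub hz), ← ofReal_norm, ← ENNReal.ofReal_pow (norm_nonneg _),
    ← ENNReal.ofReal_mul hpos.le, ← ENNReal.ofReal_mul (hc.le.trans (hc' z hz))]
  refine ENNReal.ofReal_le_ofReal ?_
  have h2 := pow_le_pow_left₀ ha.le (hb z hz).1 2
  calc a ^ 2 * c * ‖coord n x₀ s z‖ ^ 2 ≤
      frameNorm h x₀ z ^ 2 * Θ.volDensity φ z * ‖coord n x₀ s z‖ ^ 2 := by
        gcongr
        exact hc' z hz
    _ = _ := by ring

end Volume

end Coordinates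

/-! ### The topology of H⁰ in coordinates, and its completeness -/

section Restriction

variable {n : ℕ} {X : Type*} [TopologicalSpace X] [ChartedSpace (EuclideanSpace ℂ (Fin n)) X]
  [IsManifold 𝓘(ℂ, EuclideanSpace ℂ (Fin n)) ω X]
  {L : X → Type*} [TopologicalSpace (TotalSpace ℂ L)]
  [∀ x, AddCommGroup (L x)] [∀ x, Module ℂ (L x)] [∀ x, TopologicalSpace (L x)]
  [FiberBundle ℂ L] [VectorBundle ℂ ℂ L]
  [ContMDiffVectorBundle ω ℂ L 𝓘(ℂ, EuclideanSpace ℂ (Fin n))]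
  {h : HermitianMetric n L}

variable (h) in
/-- The coordinate expression of holomorphic sections, as continuous functions on a closed ball. -/
def res (x₀ : X) {t : ℝ} (ht : t ≤ 2) : HolSection h →ₗ[ℂ] C(chartBall n L x₀ t, ℂ) where
  toFun s := ⟨fun z => coord n x₀ s z, continuousOn_iff_continuous_domRestrict.1
    ((differentiableOn_coord s x₀).continuousOn.mono (chartBall_subset ht))⟩
  map_add' s t := by
    ext z
    exact coord_add (chartBall_subset ht z.2) _ _
  map_smul' c s := by
    ext z
    exact coord_smul (chartBall_subset ht z.2) _ _

lemma res_apply (x₀ : X) {t : ℝ} (ht : t ≤ 2) (s : HolSection h) (z : chartBall n L x₀ t) :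
    res h x₀ ht s z = coord n x₀ s z := rfl

/-- Mean value inequality on the ball of size u about z, which lies in the concentric ball of size t
+ u. -/
lemma enorm_sq_coord_mul_le (s : HolSection h) (x₀ : X) {t u : ℝ} (htu : t + u ≤ 2)
    {z : EuclideanSpace ℂ (Fin n)} (hz : z ∈ chartBall n L x₀ t) :
    ‖coord n x₀ s z‖ₑ ^ 2 *
      volume (Metric.closedBall (0 : EuclideanSpace ℂ (Fin n)) (u * chartRadius n L x₀)) ≤
      ∫⁻ w in chartBall n L x₀ (t + u), ‖coord n x₀ s w‖ₑ ^ 2 :=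
  (enorm_sq_mul_volume_le (differentiableOn_coord s x₀)
    ((closedBall_subset_chartBall hz).trans (chartBall_subset htu))).trans
    (lintegral_mono_set (closedBall_subset_chartBall hz))

lemma one_half_le_two : (1 / 2 : ℝ) ≤ 2 := by norm_num

variable (h) in
/-- The coordinate expressions of a holomorphic section on a family of closed balls. -/
def resFamily (t : Set X) : HolSection h →ₗ[ℂ] ∀ i : t, C(chartBall n L (i : X) (1 / 2), ℂ) :=
  LinearMap.pi fun i => res h (i : X) one_half_le_two

/-- Together with `norm_res_le_mul_supSeminorm`, this makes the coordinate norms and the seminorms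
over compact sets dominate each other; the constants are the bounds for the frame. -/
lemma norm_le_mul_norm_res (x₀ : X) : ∃ A : ℝ, 0 < A ∧ ∀ s : HolSection h, ∀ x ∈ chartNhd n L x₀,
    h.norm x (s x) ≤ A * ‖res h x₀ one_half_le_two s‖ := by
  obtain ⟨a, A, ha, hA, hb⟩ := exists_frameNorm_bounds h x₀
  refine ⟨A, hA, fun s x hx => ?_⟩
  have hz := ball_subset_chartBall x₀ hx.2
  have hz2 : chartAt (EuclideanSpace ℂ (Fin n)) x₀ x ∈ chartBall n L x₀ 2 :=
    Metric.closedBall_subset_closedBall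
      (mul_le_mul_of_nonneg_right one_half_le_two (chartRadius_pos x₀).le) hz
  have h1 := norm_eq_coord_mul h (chartBall_subset one_half_le_two hz) s
  rw [OpenPartialHomeomorph.left_inv _ hx.1] at h1
  rw [h1, mul_comm A]
  exact mul_le_mul ((res h x₀ one_half_le_two s).norm_coe_le_norm ⟨_, hz⟩) (hb _ hz2).2
    (frameNorm_pos h (chartBall_subset le_rfl hz2)).le (norm_nonneg _)

lemma norm_res_le_mul_supSeminorm (x₀ : X) : ∃ C : ℝ, 0 < C ∧ ∀ s : HolSection h,
    ‖res h x₀ one_half_le_two s‖ ≤ C * HolSection.supSeminorm h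
      ⟨_, isCompact_image_chartBall (n := n) (L := L) x₀ one_half_le_two⟩ s := by
  obtain ⟨a, A, ha, hA, hb⟩ := exists_frameNorm_bounds h x₀
  refine ⟨a⁻¹, inv_pos.2 ha, fun s => ?_⟩
  rw [ContinuousMap.norm_le _ (mul_nonneg (inv_pos.2 ha).le (apply_nonneg _ _))]
  intro z
  rw [res_apply, inv_mul_eq_div, le_div_iff₀ ha]
  have hz2 : (z : EuclideanSpace ℂ (Fin n)) ∈ chartBall n L x₀ 2 :=
    Metric.closedBall_subset_closedBall
      (mul_le_mul_of_nonneg_right one_half_le_two (chartRadius_pos x₀).le) z.2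
  calc ‖coord n x₀ s z‖ * a ≤ ‖coord n x₀ s z‖ * frameNorm h x₀ z := by
        gcongr
        exact (hb _ hz2).1
    _ = h.norm _ (s ((chartAt (EuclideanSpace ℂ (Fin n)) x₀).symm z)) :=
        (norm_eq_coord_mul h (chartBall_subset le_rfl hz2) s).symm
    _ ≤ _ := le_ciSup (s.bddAbove_norm
        ⟨_, isCompact_image_chartBall (n := n) (L := L) x₀ one_half_le_two⟩)
        ⟨_, mem_image_of_mem _ z.2⟩

/-- The topology of `H⁰(X, L)` is the one given by the coordinate expressions. -/
theorem isInducing_resFamily {t : Set X} (ht : ⋃ i ∈ t, chartNhd n L i = univ) :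
    Topology.IsInducing (resFamily h t) := by
  have h1 := withSeminorms_pi (𝕜 := ℂ) fun i : t =>
    norm_withSeminorms ℂ C(chartBall n L (i : X) (1 / 2), ℂ)
  have h2 := (resFamily h t).withSeminorms_induced h1
  have h3 : WithSeminorms ((SeminormFamily.sigma fun i : t => SeminormFamily.comp
      (fun _ : Fin 1 => normSeminorm ℂ C(chartBall n L (i : X) (1 / 2), ℂ))
      (LinearMap.proj i)).comp (resFamily h t)) := by
    refine (HolSection.withSeminorms (h := h)).congr ?_ ?_
    · rintro ⟨i, k⟩
      obtain ⟨C, hC, hb⟩ := norm_res_le_mul_supSeminorm (h := h) (i : X)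
      refine ⟨{⟨_, isCompact_image_chartBall (n := n) (L := L) (i : X) one_half_le_two⟩},
        ⟨C, hC.le⟩, fun s => ?_⟩
      rw [Finset.sup_singleton]
      exact hb s
    · intro K
      choose A hA hb using fun x₀ : X => norm_le_mul_norm_res (h := h) x₀
      obtain ⟨F, hF⟩ := K.isCompact.elim_finite_subcover (fun i : t => chartNhd n L (i : X))
        (fun i => isOpen_chartNhd _) fun x _ => by
          have : x ∈ ⋃ i ∈ t, chartNhd n L i := ht ▸ mem_univ x
          simpa using this
      -- A compact set meets only finitely many neighbourhoods of a subcover; the sum of their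
      -- constants serves for all of them.
      let C : NNReal := ∑ i ∈ F, ⟨A i, (hA i).le⟩
      refine ⟨F.map ⟨fun i => ⟨i, 0⟩, fun i j hij => (Sigma.mk.inj_iff.1 hij).1⟩, C, fun s => ?_⟩
      refine Real.iSup_le (fun x => ?_) (apply_nonneg _ _)
      obtain ⟨i, hi, hxi⟩ := mem_iUnion₂.1 (hF x.2)
      refine (hb i s x hxi).trans ?_
      have hAC : A i ≤ C := by
        have : (⟨A i, (hA i).le⟩ : NNReal) ≤ C :=
          Finset.single_le_sum (f := fun i : t => (⟨A i, (hA i).le⟩ : NNReal))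
            (fun _ _ => zero_le) hi
        exact this
      refine mul_le_mul hAC ?_ (norm_nonneg _) C.2
      refine Seminorm.le_finset_sup_apply (i := (⟨i, 0⟩ : Σ _ : t, Fin 1)) ?_ |>.trans' le_rfl
      exact Finset.mem_map.2 ⟨i, hi, rfl⟩
  exact ⟨h3.topology_eq_withSeminorms.trans
    (WithSeminorms.topology_eq_withSeminorms (topology := .induced (resFamily h t) inferInstance)
      h2).symm⟩

lemma convergesLocallyUniformly_iff_tendsto {F : ℕ → HolSection h} {s : HolSection h} :
    HolSection.ConvergesLocallyUniformly F s ↔ Tendsto F atTop (𝓝 s) := by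
  rw [HolSection.withSeminorms.tendsto_nhds]
  constructor
  · intro H K ε hε
    -- Strict pointwise bounds only give a non-strict bound for the supremum, so half of ε is used.
    filter_upwards [H K K.isCompact (ε / 2) (by positivity)] with N hN
    refine lt_of_le_of_lt (Real.iSup_le (fun x => ?_) (by positivity)) (half_lt_self hε)
    exact (hN x x.2).le
  · intro H K hK ε hε
    filter_upwards [H ⟨K, hK⟩ ε hε] with N hN x hx
    exact (le_ciSup ((F N - s).bddAbove_norm ⟨K, hK⟩) ⟨x, hx⟩).trans_lt hN

/-- Completeness of `H⁰(X, L)`. -/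
theorem exists_tendsto_of_cauchySeq_res {t : Set X} (ht : ⋃ i ∈ t, chartNhd n L i = univ)
    {F : ℕ → HolSection h}
    (hF : ∀ i ∈ t, CauchySeq fun N => res h i one_half_le_two (F N)) :
    ∃ s, Tendsto F atTop (𝓝 s) := by
  choose! f hf using fun i (hi : i ∈ t) => cauchySeq_tendsto_of_complete (hF i hi)
  have hpt : ∀ i ∈ t, ∀ z : chartBall n L i (1 / 2),
      Tendsto (fun N => coord n i (F N) z) atTop (𝓝 (f i z)) := fun i hi z =>
    ((continuous_eval_const z).tendsto _).comp (hf i hi)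
  have hcov : ∀ x : X, ∃ i ∈ t, x ∈ chartNhd n L i := fun x => by
    have : x ∈ ⋃ i ∈ t, chartNhd n L i := ht ▸ mem_univ x
    simpa using this
  have hcoord_sub : ∀ {i z}, z ∈ coordDomain n L i → ∀ (a b : ∀ x, L x),
      coord n i (a - b) z = coord n i a z - coord n i b z := fun hz a b => by
    have h1 := coord_add hz a ((-1 : ℂ) • b)
    rw [coord_smul hz, neg_one_smul, neg_one_mul, ← sub_eq_add_neg, ← sub_eq_add_neg] at h1
    exact h1
  -- the pointwise limit
  have hlim : ∀ x : X, ∃ v : L x, Tendsto (fun N => h.norm x (F N x - v)) atTop (𝓝 0) := by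
    intro x
    obtain ⟨i, hi, hx⟩ := hcov x
    set φ := chartAt (EuclideanSpace ℂ (Fin n)) i with hφ
    have hz := ball_subset_chartBall i hx.2
    have hzd := chartBall_subset one_half_le_two hz
    have hxz : φ.symm (φ x) = x := φ.left_inv hx.1
    -- The fibre is a type depending on the point, so the limit is built over `φ.symm (φ x)` and
    -- transported to x.
    suffices H : ∃ v : L (φ.symm (φ x)),
        Tendsto (fun N => h.norm _ (F N (φ.symm (φ x)) - v)) atTop (𝓝 0) by
      rwa [hxz] at H
    refine ⟨f i ⟨_, hz⟩ • (trivializationAt ℂ L i).symm (φ.symm (φ x)) 1, ?_⟩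
    have h1 : ∀ N, h.norm _ (F N (φ.symm (φ x)) -
        f i ⟨_, hz⟩ • (trivializationAt ℂ L i).symm (φ.symm (φ x)) 1) =
        ‖coord n i (F N) (φ x) - f i ⟨_, hz⟩‖ * frameNorm h i (φ x) := fun N => by
      rw [eq_coord_smul hzd (F N), ← sub_smul, h.norm_smul]
      rfl
    simp only [h1]
    have h2 := (tendsto_iff_norm_sub_tendsto_zero.1 (hpt i hi ⟨_, hz⟩)).mul_const
      (frameNorm h i (φ x))
    rwa [zero_mul] at h2
  -- Convergence in |·|_h does not mention a chart. Hence σ is a single global section, and in each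
  -- ball of the cover its coordinate expression must be the limit found there.
  choose σ hσ using hlim
  have hcoord : ∀ i ∈ t, ∀ z : chartBall n L i (1 / 2), coord n i σ z = f i z := by
    intro i hi z
    have hzd := chartBall_subset one_half_le_two z.2
    refine tendsto_nhds_unique ?_ (hpt i hi z)
    rw [tendsto_iff_norm_sub_tendsto_zero]
    have hpos := frameNorm_pos h hzd
    have h1 := (hσ ((chartAt (EuclideanSpace ℂ (Fin n)) i).symm z)).div_const (frameNorm h i z)
    rw [zero_div] at h1
    refine h1.congr fun N => ?_
    rw [div_eq_iff hpos.ne', ← hcoord_sub hzd]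
    exact norm_eq_coord_mul h hzd ((F N).toSection - σ)
  have hhol : MDifferentiable 𝓘(ℂ, EuclideanSpace ℂ (Fin n))
      (𝓘(ℂ, EuclideanSpace ℂ (Fin n)).prod 𝓘(ℂ, ℂ)) fun x => TotalSpace.mk' ℂ x (σ x) := by
    intro x
    obtain ⟨i, hi, hx⟩ := hcov x
    set φ := chartAt (EuclideanSpace ℂ (Fin n)) i with hφ
    have hz := ball_subset_chartBall i hx.2
    have hu : TendstoUniformlyOn (fun N => coord n i (F N)) (coord n i σ) atTop
        (Metric.ball (φ i) (1 / 2 * chartRadius n L i)) := by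
      rw [Metric.tendstoUniformlyOn_iff]
      intro ε hε
      filter_upwards [Metric.tendsto_nhds.1 (hf i hi) ε hε] with N hN z hz
      have hz' := ball_subset_chartBall i hz
      rw [dist_comm, hcoord i hi ⟨z, hz'⟩]
      exact (ContinuousMap.dist_apply_le_dist (⟨z, hz'⟩ : chartBall n L i (1 / 2))).trans_lt hN
    have hd := differentiableOn_of_tendstoUniformlyOn Metric.isOpen_ball
      (fun N => (differentiableOn_coord (F N) i).mono
        ((ball_subset_chartBall i).trans (chartBall_subset one_half_le_two))) hu
    have := mdifferentiableAt_of_coord (chartBall_subset one_half_le_two hz)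
      (hd.differentiableAt (Metric.isOpen_ball.mem_nhds hx.2))
    rwa [OpenPartialHomeomorph.left_inv _ hx.1] at this
  let s : HolSection h := ⟨σ, hhol⟩
  refine ⟨s, ?_⟩
  rw [(isInducing_resFamily ht).tendsto_nhds_iff, tendsto_pi_nhds]
  rintro ⟨i, hi⟩
  have : res h i one_half_le_two s = f i := by
    ext z
    exact hcoord i hi z
  change Tendsto (fun N => res h i one_half_le_two (F N)) atTop (𝓝 (res h i one_half_le_two s))
  rw [this]
  exact hf i hi

end Restriction

/-! ### Interior estimates and the Bergman kernel in local L² spaces -/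

section Bergman

variable {n : ℕ} {X : Type*} [TopologicalSpace X] [ChartedSpace (EuclideanSpace ℂ (Fin n)) X]
  [IsManifold 𝓘(ℂ, EuclideanSpace ℂ (Fin n)) ω X]
  {L : X → Type*} [TopologicalSpace (TotalSpace ℂ L)]
  [∀ x, AddCommGroup (L x)] [∀ x, Module ℂ (L x)] [∀ x, TopologicalSpace (L x)]
  [FiberBundle ℂ L] [VectorBundle ℂ ℂ L]
  [ContMDiffVectorBundle ω ℂ L 𝓘(ℂ, EuclideanSpace ℂ (Fin n))]
  {h : HermitianMetric n L}

variable (n L) in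
/-- Lebesgue measure on a closed ball in the chart at `x₀`. -/
def chartBallMeasure (x₀ : X) : Measure (chartBall n L x₀ 1) :=
  volume.comap ((↑) : chartBall n L x₀ 1 → EuclideanSpace ℂ (Fin n))

lemma measurableSet_chartBall (x₀ : X) (t : ℝ) : MeasurableSet (chartBall n L x₀ t) :=
  (isCompact_chartBall x₀ t).measurableSet

lemma volume_closedBall_pos (x₀ : X) {u : ℝ} (hu : 0 < u) :
    0 < volume (Metric.closedBall (0 : EuclideanSpace ℂ (Fin n)) (u * chartRadius n L x₀)) :=
  Metric.measure_closedBall_pos _ _ (mul_pos hu (chartRadius_pos x₀))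

instance (x₀ : X) : IsFiniteMeasure (chartBallMeasure n L x₀) where
  measure_univ_lt_top := by
    rw [chartBallMeasure, comap_subtype_coe_apply (measurableSet_chartBall x₀ 1)]
    exact (measure_mono (by simp)).trans_lt (isCompact_chartBall (L := L) x₀ 1).measure_lt_top

variable (h) in
/-- The coordinate expression of a holomorphic section near `x₀`, in the local `L²` space. -/
def toL2 (x₀ : X) : HolSection h →ₗ[ℂ] Lp ℂ 2 (chartBallMeasure n L x₀) :=
  (ContinuousMap.toLp 2 (chartBallMeasure n L x₀) ℂ).toLinearMap ∘ₗ res h x₀ one_le_two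

lemma enorm_sq_toL2 (x₀ : X) (s : HolSection h) :
    ‖toL2 h x₀ s‖ₑ ^ 2 = ∫⁻ z in chartBall n L x₀ 1, ‖coord n x₀ s z‖ₑ ^ 2 := by
  have h1 : ‖toL2 h x₀ s‖ₑ = eLpNorm (res h x₀ one_le_two s) 2 (chartBallMeasure n L x₀) := by
    rw [Lp.enorm_def]
    exact eLpNorm_congr_ae (ContinuousMap.coeFn_toLp _ _)
  have h2 := eLpNorm_nnreal_pow_eq_lintegral (f := res h x₀ one_le_two s)
    (μ := chartBallMeasure n L x₀) (p := 2) two_ne_zero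
  rw [h1]
  have h3 : ∀ a : ℝ≥0∞, a ^ (((2 : NNReal) : ℝ)) = a ^ 2 := fun a => by
    rw [← ENNReal.rpow_natCast]
    norm_num
  simp only [h3] at h2
  refine h2.trans ?_
  rw [chartBallMeasure]
  exact lintegral_subtype_comap (measurableSet_chartBall x₀ 1) fun z => ‖coord n x₀ s z‖ₑ ^ 2

/-- Interior estimate: the supremum norm on a ball is controlled by the `L²` norm on a larger
ball. -/
lemma exists_norm_res_le_norm_toL2 (h : HermitianMetric n L) (x₀ : X) : ∃ C : NNReal,
    ∀ s : HolSection h, ‖res h x₀ one_half_le_two s‖ ≤ C * ‖toL2 h x₀ s‖ := by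
  set V := volume (Metric.closedBall (0 : EuclideanSpace ℂ (Fin n)) (1 / 2 * chartRadius n L x₀))
    with hV
  have hV0 : V ≠ 0 := (volume_closedBall_pos x₀ one_half_pos).ne'
  have hVt : V ≠ ⊤ := (isCompact_closedBall _ _).measure_lt_top.ne
  refine ⟨NNReal.sqrt V.toNNReal⁻¹, fun s => ?_⟩
  rw [ContinuousMap.norm_le _ (by positivity)]
  intro z
  -- A ball of size 1/2 about a point of the half ball stays in the ball of size 1; V is its volume.
  have h1 := enorm_sq_coord_mul_le s x₀ (t := 1 / 2) (u := 1 / 2) (by norm_num) z.2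
  rw [← hV, add_halves, ← enorm_sq_toL2, ← ENNReal.coe_toNNReal hVt, enorm_eq_nnnorm,
    enorm_eq_nnnorm] at h1
  norm_cast at h1
  have hV1 : 0 < V.toNNReal := ENNReal.toNNReal_pos hV0 hVt
  have h2 : ‖coord n x₀ s z‖₊ ≤ NNReal.sqrt V.toNNReal⁻¹ * ‖toL2 h x₀ s‖₊ := by
    refine (pow_le_pow_iff_left₀ zero_le zero_le two_ne_zero).1 ?_
    rw [mul_pow, NNReal.sq_sqrt, inv_mul_eq_div]
    exact (le_div_iff₀ hV1).2 h1
  exact NNReal.coe_le_coe.2 h2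

section L2

variable [MeasurableSpace X] [BorelSpace X] {Θ : HermitianForm n X}

lemma lintegral_sq_norm_toHol (s : L2HolSection Θ h) :
    ∫⁻ x, ENNReal.ofReal (h.norm x (s.toHol x) ^ 2) ∂Θ.vol = ENNReal.ofReal (‖s‖ ^ 2) := by
  have hs : Integrable (fun x => h.norm x (s.toHol x) ^ 2) Θ.vol := s.2
  rw [← ofReal_integral_eq_lintegral_ofReal hs (.of_forall fun _ => sq_nonneg _),
    @norm_sq_eq_re_inner ℂ]
  congr 1
  have h1 := integral_re (integrable_inner hs hs)
  have h2 : ∀ x, h.norm x (s.toHol x) ^ 2 = RCLike.re (h.inner x (s.toHol x) (s.toHol x)) :=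
    fun x => h.sq_norm x _
  simp only [h2]
  exact h1

variable (h Θ) in
/-- The inclusion of the square integrable sections into all holomorphic sections. -/
def toHolₗ : L2HolSection Θ h →ₗ[ℂ] HolSection h := (l2Submodule Θ h).subtype

lemma toHolₗ_apply (s : L2HolSection Θ h) : toHolₗ h Θ s = s.toHol := rfl

variable [SecondCountableTopology X]

/-- Point evaluations are locally uniformly bounded on `H⁰₍₂₎(X, L)`. -/
lemma exists_norm_coord_le (Θ : HermitianForm n X) (h : HermitianMetric n L) (x₀ : X) :
    ∃ C : NNReal, ∀ s : L2HolSection Θ h, ∀ z ∈ chartBall n L x₀ 1,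
      ‖coord n x₀ s.toHol z‖ ≤ C * ‖s‖ := by
  obtain ⟨M, hM, hb⟩ := exists_lintegral_coord_le Θ h x₀
  set V := volume (Metric.closedBall (0 : EuclideanSpace ℂ (Fin n)) (1 * chartRadius n L x₀))
    with hV
  have hV0 : V ≠ 0 := (volume_closedBall_pos x₀ one_pos).ne'
  have hVt : V ≠ ⊤ := (isCompact_closedBall _ _).measure_lt_top.ne
  have hV1 : 0 < V.toNNReal := ENNReal.toNNReal_pos hV0 hVt
  refine ⟨NNReal.sqrt (M.toNNReal / V.toNNReal), fun s z hz => ?_⟩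
  have h1 := enorm_sq_coord_mul_le s.toHol x₀ (t := 1) (u := 1) (by norm_num) hz
  rw [one_add_one_eq_two] at h1
  have h2 := h1.trans (hb s.toHol)
  rw [lintegral_sq_norm_toHol, ENNReal.ofReal_pow (norm_nonneg _), ofReal_norm, ← hV,
    ← ENNReal.coe_toNNReal hVt, ← ENNReal.coe_toNNReal hM, enorm_eq_nnnorm, enorm_eq_nnnorm] at h2
  norm_cast at h2
  have h3 : ‖coord n x₀ s.toHol z‖₊ ≤ NNReal.sqrt (M.toNNReal / V.toNNReal) * ‖s‖₊ := by
    refine (pow_le_pow_iff_left₀ zero_le zero_le two_ne_zero).1 ?_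
    rw [mul_pow, NNReal.sq_sqrt, div_mul_eq_mul_div]
    exact (le_div_iff₀ hV1).2 h2
  exact NNReal.coe_le_coe.2 h3

/-- The Bergman kernel on the diagonal is locally integrable. -/
lemma summable_sq_norm_toL2 {ι : Type*} {S : ι → L2HolSection Θ h} (hS : Orthonormal ℂ S)
    (x₀ : X) : Summable fun j => ‖toL2 h x₀ (S j).toHol‖ ^ 2 := by
  obtain ⟨C, hC⟩ := exists_norm_coord_le Θ h x₀
  -- Bessel's inequality for evaluation at z, with a bound C independent of z: the finite Bergman
  -- sums are at most C² on the ball, and integration gives C² times its volume.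
  have hpt : ∀ F : Finset ι, ∀ z ∈ chartBall n L x₀ 1,
      ∑ j ∈ F, ‖coord n x₀ (S j).toHol z‖ₑ ^ 2 ≤ (C : ℝ≥0∞) ^ 2 := by
    intro F z hz
    let l : L2HolSection Θ h →ₗ[ℂ] ℂ :=
      { toFun := fun s => coord n x₀ s.toHol z
        map_add' := fun s t => coord_add (chartBall_subset one_le_two hz) _ _
        map_smul' := fun c s => coord_smul (chartBall_subset one_le_two hz) _ _ }
    have h1 : ∑ j ∈ F, ‖coord n x₀ (S j).toHol z‖ ^ 2 ≤ (C : ℝ) ^ 2 :=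
      sum_sq_norm_apply_le hS (l := l) (fun s => hC s z hz) F
    have h2 : ∑ j ∈ F, ‖coord n x₀ (S j).toHol z‖₊ ^ 2 ≤ C ^ 2 := by
      rw [← NNReal.coe_le_coe]
      push_cast
      exact h1
    simp only [enorm_eq_nnnorm]
    exact_mod_cast h2
  set W := volume (chartBall n L x₀ 1) with hW
  have hWt : W ≠ ⊤ := (isCompact_chartBall x₀ 1).measure_lt_top.ne
  refine summable_of_sum_le (c := ((C ^ 2 * W.toNNReal : NNReal) : ℝ)) (fun _ => sq_nonneg _)
    fun F => ?_
  have h1 : ∑ j ∈ F, ‖toL2 h x₀ (S j).toHol‖ₑ ^ 2 ≤ (C : ℝ≥0∞) ^ 2 * W := by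
    simp only [enorm_sq_toL2]
    rw [← lintegral_finsetSum' _ fun j _ => ?_]
    · refine (setLIntegral_mono' (measurableSet_chartBall x₀ 1) (hpt F)).trans_eq ?_
      rw [setLIntegral_const]
    · have hc := (differentiableOn_coord (S j).toHol x₀).continuousOn.mono
        (chartBall_subset (L := L) one_le_two)
      exact (hc.aemeasurable (measurableSet_chartBall x₀ 1)).enorm.pow_const 2
  rw [← ENNReal.coe_toNNReal hWt] at h1
  simp only [enorm_eq_nnnorm] at h1
  norm_cast at h1
  rw [← NNReal.coe_le_coe] at h1
  push_cast at h1 ⊢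
  exact h1

/-- The inclusion of `H⁰₍₂₎(X, L)` into `H⁰(X, L)` is bounded in coordinates. -/
lemma exists_norm_res_toHol_le (Θ : HermitianForm n X) (h : HermitianMetric n L) (x₀ : X) :
    ∃ C : NNReal, ∀ s : L2HolSection Θ h, ‖res h x₀ one_half_le_two s.toHol‖ ≤ C * ‖s‖ := by
  obtain ⟨C, hC⟩ := exists_norm_coord_le Θ h x₀
  refine ⟨C, fun s => ?_⟩
  rw [ContinuousMap.norm_le _ (by positivity)]
  intro z
  refine hC s z (Metric.closedBall_subset_closedBall
      (mul_le_mul_of_nonneg_right ?_ (chartRadius_pos x₀).le) z.2)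
  norm_num

end L2

end Bergman

/-- A finite measure on a countable product of separable Banach spaces is determined by the
characteristic functionals of its finite dimensional marginals. -/
lemma ext_of_integral_exp_restrict {ι : Type*} {B : ι → Type*}
    [∀ i, NormedAddCommGroup (B i)] [∀ i, NormedSpace ℝ (B i)] [∀ i, CompleteSpace (B i)]
    [∀ i, SecondCountableTopology (B i)] [∀ i, MeasurableSpace (B i)] [∀ i, BorelSpace (B i)]
    {μ ν : Measure (∀ i, B i)} [IsFiniteMeasure μ] [IsFiniteMeasure ν]
    (H : ∀ (I : Finset ι) (l : StrongDual ℝ (∀ i : I, B i)),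
      ∫ v, Complex.exp (l (I.restrict v) * Complex.I) ∂μ =
        ∫ v, Complex.exp (l (I.restrict v) * Complex.I) ∂ν) : μ = ν := by
  -- Finite marginals determine the measure, and each marginal lives on a separable Banach space,
  -- where the characteristic functional determines it.
  refine IsProjectiveLimit.unique (P := fun I => ν.map I.restrict) (fun I => ?_) (fun I => rfl)
  refine Measure.ext_of_charFunDual (funext fun l => ?_)
  have hm : Measurable (I.restrict : (∀ i, B i) → _) := Finset.measurable_restrict I
  rw [charFunDual_apply, charFunDual_apply,
    integral_map hm.aemeasurable (Continuous.aestronglyMeasurable (by fun_prop)),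
    integral_map hm.aemeasurable (Continuous.aestronglyMeasurable (by fun_prop))]
  exact H I l

/-! ### Gaussian random sections: convergence and law -/

section Series

variable {n : ℕ} {X : Type*} [TopologicalSpace X] [ChartedSpace (EuclideanSpace ℂ (Fin n)) X]
  [IsManifold 𝓘(ℂ, EuclideanSpace ℂ (Fin n)) ω X]
  {L : X → Type*} [TopologicalSpace (TotalSpace ℂ L)]
  [∀ x, AddCommGroup (L x)] [∀ x, Module ℂ (L x)] [∀ x, TopologicalSpace (L x)]
  [FiberBundle ℂ L] [VectorBundle ℂ ℂ L]
  [ContMDiffVectorBundle ω ℂ L 𝓘(ℂ, EuclideanSpace ℂ (Fin n))]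
  {h : HermitianMetric n L}

lemma exists_countable_cover_chartNhd [SecondCountableTopology X] :
    ∃ t : Set X, t.Countable ∧ ⋃ i ∈ t, chartNhd n L i = univ :=
  TopologicalSpace.countable_cover_nhds fun x => (isOpen_chartNhd x).mem_nhds (mem_chartNhd x)

instance : IsTopologicalAddGroup (HolSection h) := HolSection.withSeminorms.topologicalAddGroup

instance : ContinuousSMul ℂ (HolSection h) := HolSection.withSeminorms.continuousSMul

/-- Countably many balls suffice, so the topology is induced from a countable product of normed
spaces. Metrizability is what makes almost everywhere limits of measurable maps into H⁰ measurable.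
-/
instance [SecondCountableTopology X] : TopologicalSpace.PseudoMetrizableSpace (HolSection h) := by
  obtain ⟨t, htc, ht⟩ := exists_countable_cover_chartNhd (n := n) (X := X) (L := L)
  have : Countable t := htc
  exact (isInducing_resFamily ht).pseudoMetrizableSpace

section L2

variable [MeasurableSpace X] [BorelSpace X] {Θ : HermitianForm n X} {d : ℕ∞}

lemma partialSum_eq_sum (S : BasisIndex d → L2HolSection Θ h) (c : BasisIndex d → ℂ) (N : ℕ) :
    partialSum S c N = ∑ j ∈ Finset.subtype (fun j : ℕ => (j : ℕ∞) < d) (Finset.range N),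
      c j • (S j).toHol := by
  let g : ℕ → HolSection h := fun j =>
    if hj : (j : ℕ∞) < d then c ⟨j, hj⟩ • (S ⟨j, hj⟩).toHol else 0
  have h1 : ∀ j : BasisIndex d, c j • (S j).toHol = g j := fun j => by
    simp only [g, dif_pos j.2]
  simp only [h1]
  rw [Finset.sum_subtype_eq_sum_filter, Finset.sum_filter_of_ne]
  · rfl
  · intro j _ hj
    by_contra hjd
    exact hj (dif_neg hjd)

/-- Unconditional sums over the index set can thus be evaluated along the partial sums, for finite
and infinite d alike. -/
lemma tendsto_subtype_range : Tendsto
    (fun N => Finset.subtype (fun j : ℕ => (j : ℕ∞) < d) (Finset.range N)) atTop atTop := by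
  refine tendsto_atTop_finset_of_monotone (fun N N' hN => ?_) fun j => ⟨j + 1, ?_⟩
  · exact Finset.subtype_mono (Finset.range_mono hN)
  · simp

lemma aemeasurable_partialSum {Ω : Type*} [MeasurableSpace Ω] {P : Measure Ω}
    (S : BasisIndex d → L2HolSection Θ h) {η : BasisIndex d → Ω → ℂ}
    (hη : ∀ j, AEMeasurable (η j) P) (N : ℕ) :
    AEMeasurable (fun w => partialSum S (fun j => η j w) N) P := by
  simp only [partialSum_eq_sum]
  set F := Finset.subtype (fun j : ℕ => (j : ℕ∞) < d) (Finset.range N)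
  -- A partial sum is a continuous function of finitely many coefficients; this avoids measurability
  -- of addition on H⁰.
  have h1 : Continuous fun c : F → ℂ => ∑ j : F, c j • (S j).toHol := by fun_prop
  have h2 : AEMeasurable (fun w (j : F) => η j w) P := aemeasurable_pi_lambda _ fun j => hη j
  refine (h1.measurable.comp_aemeasurable h2).congr (.of_forall fun w => ?_)
  exact Finset.sum_coe_sort F fun j => η j w • (S j).toHol

variable [SecondCountableTopology X]

/-- For finite d the partial sums are eventually constant. For d = ∞ they are almost surely Cauchy
in every local L² space of a countable cover, hence uniformly Cauchy on the half balls, and H⁰ is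
complete. -/
lemma ae_exists_tendsto_partialSum {Ω : Type*} [MeasurableSpace Ω] {P : Measure Ω}
    [IsProbabilityMeasure P] {S : BasisIndex d → L2HolSection Θ h} {η : BasisIndex d → Ω → ℂ}
    (hS : Orthonormal ℂ S) (hη : IsIIDCenteredGaussian η P) :
    ∀ᵐ w ∂P, ∃ s, Tendsto (partialSum S fun j => η j w) atTop (𝓝 s) := by
  induction d using ENat.recTopCoe with
  | coe m =>
    refine .of_forall fun w => ⟨partialSum S (fun j => η j w) m, ?_⟩
    refine tendsto_const_nhds.congr' ?_
    filter_upwards [eventually_ge_atTop m] with N hN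
    refine Finset.sum_subset (Finset.range_mono hN) fun j _ hj => dif_neg ?_
    rw [Finset.mem_range] at hj
    exact_mod_cast hj
  | top =>
    let e : ℕ → BasisIndex ⊤ := fun j => ⟨j, ENat.natCast_lt_top j⟩
    have he : Function.Injective e := fun i j hij => congrArg Subtype.val hij
    have hps : ∀ c N, partialSum S c N = ∑ j ∈ Finset.range N, c (e j) • (S (e j)).toHol :=
      fun c N => Finset.sum_congr rfl fun j _ => dif_pos (ENat.natCast_lt_top j)
    have hm : ∀ j, AEStronglyMeasurable (η j) P := fun j =>
      (hη.gaussian j).aemeasurable.aestronglyMeasurable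
    -- The natural filtration needs strongly measurable variables; the η_j are only almost
    -- everywhere measurable and are replaced by such versions.
    let η' : ℕ → Ω → ℂ := fun j => (hm (e j)).mk
    have hae : ∀ j, η (e j) =ᵐ[P] η' j := fun j => (hm (e j)).ae_eq_mk
    have hL : ∀ j, MemLp (η' j) 2 P := fun j =>
      (memLp_congr_ae (hae j)).1 (hη.gaussian (e j)).memLp_two
    have h0 : ∀ j, ∫ w, η' j w ∂P = 0 := fun j => by
      rw [← integral_congr_ae (hae j)]
      exact hη.centered _
    have hi : iIndepFun η' P := (hη.indep.precomp he).congr hae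
    have hσ : ∀ j, ∫ w, ‖η' j w‖ ^ 2 ∂P = ∫ w, ‖η (e 0) w‖ ^ 2 ∂P := fun j => by
      have h1 : ∫ w, ‖η' j w‖ ^ 2 ∂P = ∫ w, ‖η (e j) w‖ ^ 2 ∂P := by
        refine integral_congr_ae ?_
        filter_upwards [hae j] with w hw
        rw [hw]
      rw [h1]
      exact ((hη.identDistrib (e j) (e 0)).comp (u := fun z : ℂ => ‖z‖ ^ 2)
        (by fun_prop)).integral_eq
    obtain ⟨t, htc, ht⟩ := exists_countable_cover_chartNhd (n := n) (X := X) (L := L)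
    have key : ∀ᵐ w ∂P, ∀ i ∈ t, CauchySeq fun N =>
        ∑ j ∈ Finset.range N, η' j w • toL2 h i (S (e j)).toHol := by
      rw [ae_ball_iff htc]
      intro i _
      exact ae_cauchySeq_sum_smul (fun j => (hm (e j)).stronglyMeasurable_mk) hL h0 hi hσ
        (summable_sq_norm_toL2 (hS.comp e he) i)
    filter_upwards [key, ae_all_iff.2 hae] with w hw hw'
    refine exists_tendsto_of_cauchySeq_res ht fun i hi => ?_
    obtain ⟨C, hC⟩ := exists_norm_res_le_norm_toL2 h i
    have h1 : ∀ N, toL2 h i (partialSum S (fun j => η j w) N) =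
        ∑ j ∈ Finset.range N, η' j w • toL2 h i (S (e j)).toHol := fun N => by
      rw [hps, map_sum]
      exact Finset.sum_congr rfl fun j _ => by rw [map_smul, hw' j]
    have h2 := hw i hi
    simp only [← h1] at h2
    rw [Metric.cauchySeq_iff] at h2 ⊢
    intro ε hε
    -- The constant C may vanish, hence C + 1.
    obtain ⟨N₀, hN₀⟩ := h2 (ε / (C + 1)) (by positivity)
    refine ⟨N₀, fun N hN M hM => ?_⟩
    have h3 := hN₀ N hN M hM
    rw [dist_eq_norm, ← map_sub, lt_div_iff₀ (by positivity)] at h3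
    rw [dist_eq_norm, ← map_sub]
    refine (hC _).trans_lt (lt_of_le_of_lt ?_ h3)
    rw [mul_comm]
    gcongr
    linarith

/-- The characteristic functional of a Gaussian random section. -/
lemma integral_exp_of_isGaussianSeries {Ω : Type*} [MeasurableSpace Ω] {P : Measure Ω}
    [IsProbabilityMeasure P] {S : BasisIndex d → L2HolSection Θ h} {η : BasisIndex d → Ω → ℂ}
    (hη : IsIIDStdComplexGaussian η P) {ψ : Ω → HolSection h} (hψ : IsGaussianSeries P S η ψ)
    {l : HolSection h →ₗ[ℂ] ℂ} (hl : Continuous l)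
    (hsum : Summable fun j => ‖l (S j).toHol‖ ^ 2) :
    ∫ w, Complex.exp ((l (ψ w)).re * Complex.I) ∂P =
      Complex.exp (-((∑' j, ‖l (S j).toHol‖ ^ 2) / 4 : ℝ)) := by
  have hm : ∀ N, AEMeasurable (fun w => partialSum S (fun j => η j w) N) P :=
    aemeasurable_partialSum S fun j => (hη.law j).aemeasurable
  have hcont : Continuous fun s : HolSection h => Complex.exp ((l s).re * Complex.I) := by
    fun_prop
  have h1 : Tendsto (fun N => ∫ w, Complex.exp
      ((l (partialSum S (fun j => η j w) N)).re * Complex.I) ∂P) atTop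
      (𝓝 (∫ w, Complex.exp ((l (ψ w)).re * Complex.I) ∂P)) := by
    -- The integrands have modulus one, so almost sure convergence of the partial sums passes to the
    -- expectations.
    refine tendsto_integral_of_dominated_convergence (fun _ => 1)
      (fun N => (hcont.measurable.comp_aemeasurable (hm N)).aestronglyMeasurable)
      (integrable_const _) (fun N => .of_forall fun w => ?_) ?_
    · exact (Complex.norm_exp_ofReal_mul_I _).le
    · filter_upwards [hψ] with w hw
      exact (hcont.tendsto _).comp (convergesLocallyUniformly_iff_tendsto.1 hw)
  have h2 : ∀ N, ∫ w, Complex.exp ((l (partialSum S (fun j => η j w) N)).re * Complex.I) ∂P =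
      Complex.exp (-((∑ j ∈ Finset.subtype (fun j : ℕ => (j : ℕ∞) < d) (Finset.range N),
        ‖l (S j).toHol‖ ^ 2) / 4 : ℝ)) := fun N => by
    rw [← integral_exp_sum_mul hη]
    simp only [partialSum_eq_sum, map_sum, map_smul, smul_eq_mul]
  simp only [h2] at h1
  refine tendsto_nhds_unique h1 ?_
  have h3 : Continuous fun x : ℝ => Complex.exp (-(x / 4 : ℝ)) := by fun_prop
  exact (h3.tendsto _).comp (hsum.hasSum.comp tendsto_subtype_range)

/-- The characteristic functional of a Gaussian random section does not depend on the orthonormal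
basis. -/
lemma integral_exp_eq_of_isGaussianSeries {Ω Ω' : Type*} [MeasurableSpace Ω] [MeasurableSpace Ω']
    {P : Measure Ω} [IsProbabilityMeasure P] {P' : Measure Ω'} [IsProbabilityMeasure P']
    {S S' : BasisIndex d → L2HolSection Θ h} {η : BasisIndex d → Ω → ℂ}
    {η' : BasisIndex d → Ω' → ℂ} {ψ : Ω → HolSection h} {ψ' : Ω' → HolSection h}
    (hS : L2HolSection.IsOrthonormalBasis Θ h S) (hS' : L2HolSection.IsOrthonormalBasis Θ h S')
    (hη : IsIIDStdComplexGaussian η P) (hη' : IsIIDStdComplexGaussian η' P')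
    (hψ : IsGaussianSeries P S η ψ) (hψ' : IsGaussianSeries P' S' η' ψ')
    {W : Type*} [NormedAddCommGroup W] [NormedSpace ℂ W] [NormedSpace ℝ W] [IsScalarTower ℝ ℂ W]
    {R : HolSection h →ₗ[ℂ] W} (hR : Continuous R) {M : ℝ}
    (hM : ∀ s : L2HolSection Θ h, ‖R s.toHol‖ ≤ M * ‖s‖) (l : StrongDual ℝ W) :
    ∫ w, Complex.exp (l (R (ψ w)) * Complex.I) ∂P =
      ∫ w, Complex.exp (l (R (ψ' w)) * Complex.I) ∂P' := by
  -- Every real functional is the real part of a complex one, to which Parseval's identity applies.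
  obtain ⟨lC, hre⟩ : ∃ lC : StrongDual ℂ W, ∀ v, l v = (lC v).re :=
    ⟨l.extendRCLike, fun v => (StrongDual.re_extendRCLike_apply (𝕜 := ℂ) l v).symm⟩
  obtain ⟨lH, hlHv⟩ : ∃ lH : HolSection h →ₗ[ℂ] ℂ, ∀ s, lH s = lC (R s) :=
    ⟨lC.toLinearMap ∘ₗ R, fun _ => rfl⟩
  have hlH : Continuous lH := (lC.continuous.comp hR).congr fun s => (hlHv s).symm
  have hbound : ∀ s : L2HolSection Θ h, ‖(lH ∘ₗ toHolₗ h Θ) s‖ ≤ (‖lC‖ * M) * ‖s‖ := fun s => by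
    rw [LinearMap.comp_apply, toHolₗ_apply, hlHv, mul_assoc]
    exact (lC.le_opNorm _).trans (mul_le_mul_of_nonneg_left (hM s) (norm_nonneg _))
  simp only [hre, ← hlHv]
  have e3 : ∑' j, ‖lH (S j).toHol‖ ^ 2 = ∑' j, ‖lH (S' j).toHol‖ ^ 2 :=
    tsum_sq_norm_apply_eq hS.orthonormal hS.dense hS'.orthonormal hS'.dense hbound
  have s1 : Summable fun j => ‖(lH ∘ₗ toHolₗ h Θ) (S j)‖ ^ 2 :=
    summable_sq_norm_apply hS.orthonormal hbound
  have s2 : Summable fun j => ‖(lH ∘ₗ toHolₗ h Θ) (S' j)‖ ^ 2 :=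
    summable_sq_norm_apply hS'.orthonormal hbound
  rw [integral_exp_of_isGaussianSeries hη hψ hlH s1,
    integral_exp_of_isGaussianSeries hη' hψ' hlH s2, e3]

/-- The law of a Gaussian random section does not depend on the orthonormal basis. -/
theorem identDistrib_of_isGaussianSeries {Ω Ω' : Type*} [MeasurableSpace Ω] [MeasurableSpace Ω']
    {P : Measure Ω} [IsProbabilityMeasure P] {P' : Measure Ω'} [IsProbabilityMeasure P']
    {S S' : BasisIndex d → L2HolSection Θ h} {η : BasisIndex d → Ω → ℂ}
    {η' : BasisIndex d → Ω' → ℂ} {ψ : Ω → HolSection h} {ψ' : Ω' → HolSection h}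
    (hS : L2HolSection.IsOrthonormalBasis Θ h S) (hS' : L2HolSection.IsOrthonormalBasis Θ h S')
    (hη : IsIIDStdComplexGaussian η P) (hη' : IsIIDStdComplexGaussian η' P')
    (hψ : IsGaussianSeries P S η ψ) (hψ' : IsGaussianSeries P' S' η' ψ') :
    IdentDistrib ψ ψ' P P' := by
  obtain ⟨t, htc, ht⟩ := exists_countable_cover_chartNhd (n := n) (X := X) (L := L)
  have : Countable t := htc
  have hT := isInducing_resFamily (h := h) ht
  have hψm : AEMeasurable ψ P := by
    refine aemeasurable_of_tendsto_metrizable_ae atTop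
      (aemeasurable_partialSum S fun j => (hη.law j).aemeasurable) ?_
    filter_upwards [hψ] with w hw using convergesLocallyUniformly_iff_tendsto.1 hw
  have hψm' : AEMeasurable ψ' P' := by
    refine aemeasurable_of_tendsto_metrizable_ae atTop
      (aemeasurable_partialSum S' fun j => (hη'.law j).aemeasurable) ?_
    filter_upwards [hψ'] with w hw using convergesLocallyUniformly_iff_tendsto.1 hw
  refine ⟨hψm, hψm', ?_⟩
  let _ : ∀ i : t, MeasurableSpace C(chartBall n L (i : X) (1 / 2), ℂ) := fun _ => borel _
  have _ : ∀ i : t, BorelSpace C(chartBall n L (i : X) (1 / 2), ℂ) := fun _ => ⟨rfl⟩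
  have hTm : Measurable (resFamily h t) := hT.continuous.measurable
  have : IsProbabilityMeasure (P.map ψ) := Measure.isProbabilityMeasure_map hψm
  have : IsProbabilityMeasure (P'.map ψ') := Measure.isProbabilityMeasure_map hψm'
  -- The two laws are compared after the map to the countable product, through finite marginals.
  have hmap : (P.map ψ).map (resFamily h t) = (P'.map ψ').map (resFamily h t) := by
    refine ext_of_integral_exp_restrict fun I l => ?_
    have hc : Continuous fun v : ∀ i : t, C(chartBall n L (i : X) (1 / 2), ℂ) =>
        Complex.exp (l (I.restrict v) * Complex.I) := by
      have : Continuous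
          (I.restrict : (∀ i : t, C(chartBall n L (i : X) (1 / 2), ℂ)) → _) :=
        Finset.continuous_restrict I
      fun_prop
    have hcT : Continuous fun s =>
        Complex.exp (l (I.restrict (resFamily h t s)) * Complex.I) := hc.comp hT.continuous
    rw [integral_map hTm.aemeasurable hc.aestronglyMeasurable,
      integral_map hTm.aemeasurable hc.aestronglyMeasurable,
      integral_map hψm hcT.aestronglyMeasurable, integral_map hψm' hcT.aestronglyMeasurable]
    let R : HolSection h →ₗ[ℂ] ∀ i : I, C(chartBall n L (i : X) (1 / 2), ℂ) :=
      LinearMap.pi fun i => res h (i : X) one_half_le_two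
    have hR : Continuous R := (Finset.continuous_restrict I).comp hT.continuous
    choose C hC using fun i : I => exists_norm_res_toHol_le Θ h (i : X)
    refine integral_exp_eq_of_isGaussianSeries hS hS' hη hη' hψ hψ' hR
      -- The finite product carries the maximum norm, which the sum of the individual bounds
      -- controls.
      (M := ∑ i, (C i : ℝ)) (fun s => ?_) l
    refine (pi_norm_le_iff_of_nonneg (by positivity)).2 fun i => (hC i s).trans ?_
    gcongr
    exact Finset.single_le_sum (f := fun i => (C i : ℝ)) (fun _ _ => NNReal.coe_nonneg _)
      (Finset.mem_univ i)
  refine Measure.ext fun A hA => ?_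
  -- The topology is induced, so every Borel set of H⁰ is the preimage of a measurable set of the
  -- product; equality of the images gives equality of the laws.
  have hcomap : (inferInstance : MeasurableSpace (HolSection h)) =
      MeasurableSpace.comap (resFamily h t) inferInstance := by
    have h1 : borel (HolSection h) = _ := congrArg (fun τ => @borel _ τ) hT.eq_induced
    rw [borel_comap] at h1
    refine h1.trans ?_
    rw [← BorelSpace.measurable_eq (α := ∀ i : t, C(chartBall n L (i : X) (1 / 2), ℂ))]
  obtain ⟨A', hA', rfl⟩ : MeasurableSet[MeasurableSpace.comap (resFamily h t) inferInstance] A :=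
    hcomap ▸ hA
  rw [← Measure.map_apply hTm hA', ← Measure.map_apply hTm hA', hmap]

end L2

end Series

end GaussSec

end

theorem mainTheorem12 {n : ℕ} {X : Type*} [TopologicalSpace X] [T2Space X]
    [SecondCountableTopology X] [ConnectedSpace X]
    [ChartedSpace (EuclideanSpace ℂ (Fin n)) X]
    [IsManifold 𝓘(ℂ, EuclideanSpace ℂ (Fin n)) ω X]
    [MeasurableSpace X] [BorelSpace X]
    {L : X → Type*} [TopologicalSpace (TotalSpace ℂ L)]
    [∀ x, AddCommGroup (L x)] [∀ x, Module ℂ (L x)] [∀ x, TopologicalSpace (L x)]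
    [FiberBundle ℂ L] [VectorBundle ℂ ℂ L]
    [ContMDiffVectorBundle ω ℂ L 𝓘(ℂ, EuclideanSpace ℂ (Fin n))]
    (Θ : GaussSec.HermitianForm n X) (h : GaussSec.HermitianMetric n L) (d : ℕ∞)
    {Ω : Type*} [MeasurableSpace Ω] (P : Measure Ω) [IsProbabilityMeasure P]
    {Ω' : Type*} [MeasurableSpace Ω'] (P' : Measure Ω') [IsProbabilityMeasure P'] :
    (∀ (S : GaussSec.BasisIndex d → GaussSec.L2HolSection Θ h)
        (η : GaussSec.BasisIndex d → Ω → ℂ),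
      GaussSec.L2HolSection.IsOrthonormalBasis Θ h S →
      GaussSec.IsIIDCenteredGaussian η P →
      ∃ ψ : Ω → GaussSec.HolSection h, Measurable ψ ∧ GaussSec.IsGaussianSeries P S η ψ) ∧
    (∀ (S S' : GaussSec.BasisIndex d → GaussSec.L2HolSection Θ h)
        (η : GaussSec.BasisIndex d → Ω → ℂ) (η' : GaussSec.BasisIndex d → Ω' → ℂ)
        (ψ : Ω → GaussSec.HolSection h) (ψ' : Ω' → GaussSec.HolSection h),
      GaussSec.L2HolSection.IsOrthonormalBasis Θ h S →
      GaussSec.L2HolSection.IsOrthonormalBasis Θ h S' →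
      GaussSec.IsIIDStdComplexGaussian η P →
      GaussSec.IsIIDStdComplexGaussian η' P' →
      GaussSec.IsGaussianSeries P S η ψ →
      GaussSec.IsGaussianSeries P' S' η' ψ' →
      IdentDistrib ψ ψ' P P') := by
  refine ⟨fun S η hS hη => ?_, fun S S' η η' ψ ψ' hS hS' hη hη' hψ hψ' =>
    GaussSec.identDistrib_of_isGaussianSeries hS hS' hη hη' hψ hψ'⟩
  -- The limit exists only almost surely; this yields a version that is defined and measurable on
  -- all of Ω.
  obtain ⟨ψ, hψ, hψ'⟩ := measurable_limit_of_tendsto_metrizable_ae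
    (GaussSec.aemeasurable_partialSum S fun j => (hη.gaussian j).aemeasurable)
    (GaussSec.ae_exists_tendsto_partialSum hS.orthonormal hη)
  refine ⟨ψ, hψ, ?_⟩
  filter_upwards [hψ'] with w hw
  exact GaussSec.convergesLocallyUniformly_iff_tendsto.2 hw
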